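/- Let $d\ge 2$ and let $\sigma$ be the surface measure on the unit sphere $\mathbb S^{d-1}\subset\mathbb R^d$, with total mass $\omega_d$. Functions on $\mathbb S^{d-1}$ take values in a fixed field $\mathbb K$, which is $\mathbb R$ or $\mathbb C$. Put $\|f\|_2=\big(\frac1{\omega_d}\int_{\mathbb S^{d-1}}|f|^2\,d\sigma\big)^{1/2}$. Let $\mathrm{proj}_n$ be the orthogonal projection of $L^2(\mathbb S^{d-1})$ onto the spherical harmonics of degree $n$, and let $(-\Delta_0)^{1/2}$ be given by $\mathrm{proj}_n[(-\Delta_0)^{1/2}f]=\sqrt{n(n+d-2)}\;\mathrm{proj}_n f$ for $n\ge 0$. Let $$W_2^1(\mathbb S^{d-1})=\{f\in L^2(\mathbb S^{d-1}) : (-\Delta_0)^{1/2}f\in L^2(\mathbb S^{d-1})\},\qquad \|\nabla_0 f\|_2:=\|(-\Delta_0)^{1/2}f\|_2 ,$$ and let $\tau(f)=\frac1{\omega_d}\int_{\mathbb S^{d-1}}x\,|f(x)|^2\,d\sigma(x)\in\mathbb R^d$. Call $C>0$ a Hardy–Rellich constant for $d$ if $$\int_{\mathbb S^{d-1}}|g|^2\,d\sigma\le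 C\min_{e\in\mathbb S^{d-1}}\int_{\mathbb S^{d-1}}(1-\langle x,e\rangle)\,|(-\Delta_0)^{1/2}g(x)|^2\,d\sigma(x)$$ for all $g\in W_2^1(\mathbb S^{d-1})$ with $\int_{\mathbb S^{d-1}} g\,d\sigma=0$. Let $f\in W_2^1(\mathbb S^{d-1})$ satisfy $\int_{\mathbb S^{d-1}}f\,d\sigma=0$ and $\|f\|_2=1$. Then $$1-\|\tau(f)\|=\min_{e\in\mathbb S^{d-1}}\frac1{\omega_d}\int_{\mathbb S^{d-1}}(1-\langle x,e\rangle)|f(x)|^2\,d\sigma(x)$$ and $$(1-\|\tau(f)\|)\,\|\nabla_0 f\|_2^2\ \ge\ B_d ,$$ where one may take each of the following constants: (a) $B_d=(d-1)\Big(1-\frac{2}{\sqrt{d+3}}\Big)$ if $d\ge 3$; (b) $B_d=C^{-1}$ for every Hardy–Rellich constant $C$ for $d$, if $d\ne 3$; for $d\neq 3$ such a constant exists; (c) $B_2=\frac18$ if $d=2$. Moreover, if $f\in C^1(\mathbb S^{d-1})$, then $\|\nabla_0 f\|_2^2=\frac1{\omega_d}\int_{\mathbb S^{d-1}}|\nabla_0f|^2\,d\sigma$,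 where $\nabla_0 f$ is the restriction to the sphere of the gradient of $x\mapsto f(x/\|x\|)$. -/

import Mathlib

open MeasureTheory

noncomputable section

namespace SphereUncertainty

/-- The unit sphere of `ℝ^d`. -/
abbrev Sph (d : ℕ) : Type := Metric.sphere (0 : EuclideanSpace ℝ (Fin d)) 1

/-- The normalized surface measure `dσ / ω_d` on the unit sphere of `ℝ^d`, where
`ω_d` is the total surface area. -/
def normSurface (d : ℕ) : Measure (Sph d) :=
  ((volume : Measure (EuclideanSpace ℝ (Fin d))).toSphere Set.univ)⁻¹ •
    (volume : Measure (EuclideanSpace ℝ (Fin d))).toSphere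

/-- The Laplace operator on polynomials in `d` variables. -/
def polyLaplacian {d : ℕ} (p : MvPolynomial (Fin d) ℝ) : MvPolynomial (Fin d) ℝ :=
  ∑ i, MvPolynomial.pderiv i (MvPolynomial.pderiv i p)

/-- Restriction of a polynomial to the sphere. -/
def restrict {d : ℕ} (p : MvPolynomial (Fin d) ℝ) (x : Sph d) : ℝ :=
  MvPolynomial.eval (fun i => (x : EuclideanSpace ℝ (Fin d)) i) p

/-- `sphHarmonic d n` is the set of spherical harmonics of degree `n` on the unit sphere
of `ℝ^d`: restrictions of homogeneous harmonic polynomials of degree `n`. -/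
def sphHarmonic (d n : ℕ) : Set (Sph d → ℝ) :=
  {Y | ∃ p : MvPolynomial (Fin d) ℝ, p.IsHomogeneous n ∧ polyLaplacian p = 0 ∧ Y = restrict p}

variable {𝕜 : Type*} [RCLike 𝕜] {d : ℕ}

/-- The norm `‖f‖₂ = (ω_d⁻¹ ∫ |f|² dσ)^(1/2)`. -/
def l2Norm (f : Sph d → 𝕜) : ℝ :=
  Real.sqrt (∫ x, ‖f x‖ ^ 2 ∂(normSurface d))

/-- `g = (-Δ₀)^(1/2) f`, where `Δ₀` is the Laplace-Beltrami operator of the sphere, in the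
distributional sense `proj_n g = (n (n + d - 2))^(1/2) proj_n f` for all `n`, where `proj_n` is
the orthogonal projection onto the spherical harmonics of degree `n`. Since a spherical harmonic
of degree `n` is determined by its inner products with those of degree `n`, the equality of
projections is expressed by testing against all of these. -/
def IsSqrtNegLaplacian (f g : Sph d → 𝕜) : Prop :=
  ∀ n : ℕ, ∀ Y ∈ sphHarmonic d n,
    ∫ x, Y x • g x ∂(normSurface d) =
      Real.sqrt ((n : ℝ) * ((n : ℝ) + (d : ℝ) - 2)) • ∫ x, Y x • f x ∂(normSurface d)

/-- The Sobolev space `W_2^1` of the sphere: `f ∈ L²` with `(-Δ₀)^(1/2) f ∈ L²`. -/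
def MemSobolev (f : Sph d → 𝕜) : Prop :=
  MemLp f 2 (normSurface d) ∧
    ∃ g : Sph d → 𝕜, MemLp g 2 (normSurface d) ∧ IsSqrtNegLaplacian f g

open Classical in
/-- The function `(-Δ₀)^(1/2) f ∈ L²` for `f` in `W_2^1` (unique almost everywhere, because the
spherical harmonics span a dense subspace of `L²`); zero for other `f`. -/
def sqrtNegLaplacian (f : Sph d → 𝕜) : Sph d → 𝕜 :=
  if h : ∃ g : Sph d → 𝕜, MemLp g 2 (normSurface d) ∧ IsSqrtNegLaplacian f g then h.choose else 0

/-- `‖∇₀ f‖₂ := ‖(-Δ₀)^(1/2) f‖₂` for `f` in `W_2^1`. -/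
def gradNorm (f : Sph d → 𝕜) : ℝ :=
  l2Norm (sqrtNegLaplacian f)

open Classical in
/-- The extension `F(y) = f(y / ‖y‖)` of a function on the sphere, for `y ≠ 0`. -/
def radialExt (f : Sph d → 𝕜) (y : EuclideanSpace ℝ (Fin d)) : 𝕜 :=
  if h : ‖y‖⁻¹ • y ∈ Metric.sphere (0 : EuclideanSpace ℝ (Fin d)) 1 then f ⟨‖y‖⁻¹ • y, h⟩ else 0

/-- `f ∈ C¹` on the sphere. -/
def IsC1 (f : Sph d → 𝕜) : Prop :=
  ContDiffOn ℝ 1 (radialExt f) {0}ᶜ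

/-- `|∇₀ f(x)|²` for `f ∈ C¹`, where `∇₀ f` is the restriction to the sphere of `∇ F`,
`F(y) = f(y / ‖y‖)`. -/
def tangentGradSq (f : Sph d → 𝕜) (x : Sph d) : ℝ :=
  ∑ i : Fin d,
    ‖fderiv ℝ (radialExt f) (x : EuclideanSpace ℝ (Fin d)) (EuclideanSpace.single i 1)‖ ^ 2

/-- The vector `τ(f) = ω_d⁻¹ ∫ x |f(x)|² dσ(x)` of `ℝ^d`. -/
def tau (f : Sph d → 𝕜) : EuclideanSpace ℝ (Fin d) :=
  ∫ x, (‖f x‖ ^ 2) • (x : EuclideanSpace ℝ (Fin d)) ∂(normSurface d)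

variable (𝕜 d) in
/-- `C` is an admissible constant in the Hardy-Rellich inequality
`∫ |f|² dσ ≤ C min_e ∫ (1 - ⟨x, e⟩) |(-Δ₀)^(1/2) f|² dσ` for mean-zero `f` in `W_2^1`. -/
def IsHardyRellichConst (C : ℝ) : Prop :=
  ∀ f : Sph d → 𝕜, MemSobolev f → ∫ x, f x ∂(normSurface d) = 0 →
    ∀ e : Sph d,
      ∫ x, ‖f x‖ ^ 2 ∂(normSurface d) ≤
        C * ∫ x, (1 - inner ℝ (x : EuclideanSpace ℝ (Fin d)) (e : EuclideanSpace ℝ (Fin d))) *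
          ‖sqrtNegLaplacian f x‖ ^ 2 ∂(normSurface d)

end SphereUncertainty

end

open MeasureTheory

noncomputable section

namespace SphereUncertainty

/-! ### Surface measure: rotation invariance and integration by parts -/

section Measure

open Set Filter Topology
open scoped Pointwise

variable {d : ℕ}

/-! Write `t = ⟨x, e⟩`. All of the calculus is done with the angular derivatives `D_ij = x_i ∂_j -
x_j ∂_i`, the generators of rotations in coordinate planes. Rotation invariance of the measure makes
each `D_ij` antisymmetric in `L²`, and the sum of `D_ij²` over all ordered pairs is twice the
Laplace-Beltrami operator. This gives the orthogonality of spherical harmonics of different degrees;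
with Stone-Weierstrass and the decomposition of polynomials into harmonic ones it yields a Hilbert
basis of harmonic polynomials (`nonempty_harmonicBasis`). In that basis `(-Δ₀)^(1/2)` is diagonal,
so inequalities can be proved for finite combinations, which are polynomials, and passed to the
limit. Complex functions are reduced to their real and imaginary parts.

The identity for the minimum holds because the mean of `(1 - t)|f|²` is `1 - ⟨τ(f), e⟩`.

For `d ≥ 3`, integrating `(d - 1) t = -Δ₀ t` against `|f|²` by parts and using `|∇₀ t|² = 1 - t²`,
Cauchy-Schwarz gives `(d - 1)² ‖τ‖² ≤ 4 ‖∇₀ f‖² (1 - ‖τ‖²)` (`sub_one_sq_mul_norm_tau_sq_le`).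
Together with the Poincaré bound `‖∇₀ f‖² ≥ d - 1` this is enough: the Poincaré bound serves for
small `‖τ‖`, the other one for large `‖τ‖`, and `2 / √(d + 3)` is where the two bounds agree
(`uncertainty_arith`).

For a Hardy-Rellich constant `C`, put `g = (-Δ₀)^(-1/2) f`. The inequality for `g` reads `‖g‖² ≤ C
(1 - ‖τ‖)`, while `1 = ‖f‖² = ⟨(-Δ₀)^(1/2) f, g⟩ ≤ ‖∇₀ f‖ ‖g‖` (`inv_le_of_isHardyRellichConst`).

A constant exists for `d ≠ 3` by duality with a Hardy inequality with weight `1 / (1 - t)`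
(`hardyRellich_of_hardy`). The weight is regularized to `1 / (a - t)` with `a > 1`, and `a` tends to
`1` at the end. Integration by parts against the gradient of the weight (`hardy_aux`) controls the
weighted integral with coefficient `d - 3`. For `d ≥ 4` the coefficient is positive and Poincaré
absorbs the remainder (constant 10). For `d = 2` it is negative, and the argument works in the other
direction once the function is made to vanish at `e` by subtracting a constant (constant 8, hence
`B_2 = 1/8`). -/

/-- The action of a linear isometry on the sphere. -/
def sphMap (R : EuclideanSpace ℝ (Fin d) ≃ₗᵢ[ℝ] EuclideanSpace ℝ (Fin d)) (x : Sph d) : Sph d :=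
  ⟨R x, by simp⟩

lemma continuous_sphMap (R : EuclideanSpace ℝ (Fin d) ≃ₗᵢ[ℝ] EuclideanSpace ℝ (Fin d)) :
    Continuous (sphMap R) :=
  (R.continuous.comp continuous_subtype_val).subtype_mk _

/-- `toSphere` measures a set through the volume of the cone over it; a linear isometry carries
cones to cones and preserves volume. -/
lemma measurePreserving_sphMap
    (R : EuclideanSpace ℝ (Fin d) ≃ₗᵢ[ℝ] EuclideanSpace ℝ (Fin d)) :
    MeasurePreserving (sphMap R) (normSurface d) (normSurface d) := by
  refine ⟨(continuous_sphMap R).measurable, ?_⟩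
  have key : Measure.map (sphMap R) (volume : Measure (EuclideanSpace ℝ (Fin d))).toSphere =
      (volume : Measure (EuclideanSpace ℝ (Fin d))).toSphere := by
    ext s hs
    have hm := (continuous_sphMap R).measurable
    rw [Measure.map_apply hm hs, Measure.toSphere_apply' _ hs, Measure.toSphere_apply' _ (hm hs)]
    congr 1
    have : Ioo (0 : ℝ) 1 • ((↑) '' (sphMap R ⁻¹' s) : Set (EuclideanSpace ℝ (Fin d))) =
        R ⁻¹' (Ioo (0 : ℝ) 1 • ((↑) '' s)) := by
      ext y
      simp only [Set.mem_smul, mem_image, mem_preimage]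
      constructor
      · rintro ⟨r, hr, _, ⟨x, hx, rfl⟩, rfl⟩
        exact ⟨r, hr, _, ⟨_, hx, rfl⟩, by simp [sphMap]⟩
      · rintro ⟨r, hr, _, ⟨x, hx, rfl⟩, h⟩
        refine ⟨r, hr, _, ⟨sphMap R.symm x, ?_, rfl⟩, ?_⟩
        · convert! hx
          simp [sphMap]
        · apply R.injective
          rw [← h]
          simp [sphMap]
    rw [this]
    exact R.measurePreserving.measure_preimage_emb R.toHomeomorph.measurableEmbedding _
  rw [normSurface, Measure.map_smul, key]

lemma nontrivial_euclidean (hd : 2 ≤ d) : Nontrivial (EuclideanSpace ℝ (Fin d)) := by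
  have : Nonempty (Fin d) := ⟨⟨0, by omega⟩⟩
  infer_instance

lemma isFiniteMeasure_normSurface : IsFiniteMeasure (normSurface d) := by
  constructor
  rw [normSurface, Measure.smul_apply, smul_eq_mul]
  by_cases h : (volume : Measure (EuclideanSpace ℝ (Fin d))).toSphere univ = 0
  · simp [h]
  · rw [ENNReal.inv_mul_cancel h (measure_ne_top _ _)]
    simp

/-- The cone over a point lies in a line, a proper subspace when `d ≥ 2`. This makes the pole of the
Hardy weight negligible. -/
lemma normSurface_singleton (hd : 2 ≤ d) (e : Sph d) : normSurface d {e} = 0 := by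
  rw [normSurface, Measure.smul_apply, smul_eq_mul, Measure.toSphere_apply' _ (measurableSet_singleton e)]
  have h : (volume : Measure (EuclideanSpace ℝ (Fin d)))
      (Ioo (0 : ℝ) 1 • ((↑) '' ({e} : Set (Sph d)))) = 0 := by
    refine measure_mono_null (t := (Submodule.span ℝ {(e : EuclideanSpace ℝ (Fin d))} :
      Set (EuclideanSpace ℝ (Fin d)))) ?_ (Measure.addHaar_submodule _ _ ?_)
    · rintro _ ⟨r, hr, _, ⟨x, hx, rfl⟩, rfl⟩
      obtain rfl : x = e := hx
      exact Submodule.smul_mem _ _ (Submodule.mem_span_singleton_self _)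
    · intro h
      have h1 := finrank_span_singleton (K := ℝ) (v := (e : EuclideanSpace ℝ (Fin d)))
        (by
          intro h0
          have := e.2
          simp [h0] at this)
      rw [h, finrank_top] at h1
      simp at h1
      omega
  rw [h]
  simp

end Measure
-- Rotations in coordinate planes and their infinitesimal generators.
section Rotation
open Set Filter Topology
variable {d : ℕ}

/-- The infinitesimal rotation in the `(i, j)` plane. -/
def infRot (i j : Fin d) : EuclideanSpace ℝ (Fin d) →L[ℝ] EuclideanSpace ℝ (Fin d) :=
  (EuclideanSpace.proj i : EuclideanSpace ℝ (Fin d) →L[ℝ] ℝ).smulRight (EuclideanSpace.single j 1) -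
    (EuclideanSpace.proj j : EuclideanSpace ℝ (Fin d) →L[ℝ] ℝ).smulRight (EuclideanSpace.single i 1)

lemma infRot_apply (i j : Fin d) (x : EuclideanSpace ℝ (Fin d)) :
    infRot i j x = x i • EuclideanSpace.single j 1 - x j • EuclideanSpace.single i 1 := rfl

/-- The orthogonal projection onto the `(i, j)` plane. -/
def planeProj (i j : Fin d) : EuclideanSpace ℝ (Fin d) →L[ℝ] EuclideanSpace ℝ (Fin d) :=
  (EuclideanSpace.proj i : EuclideanSpace ℝ (Fin d) →L[ℝ] ℝ).smulRight (EuclideanSpace.single i 1) +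
    (EuclideanSpace.proj j : EuclideanSpace ℝ (Fin d) →L[ℝ] ℝ).smulRight (EuclideanSpace.single j 1)

lemma planeProj_apply (i j : Fin d) (x : EuclideanSpace ℝ (Fin d)) :
    planeProj i j x = x i • EuclideanSpace.single i 1 + x j • EuclideanSpace.single j 1 := rfl

/-- Rotation by the angle `s` in the `(i, j)` plane, as a linear map. -/
def rotMap (i j : Fin d) (s : ℝ) : EuclideanSpace ℝ (Fin d) →L[ℝ] EuclideanSpace ℝ (Fin d) :=
  ContinuousLinearMap.id ℝ _ + (Real.cos s - 1) • planeProj i j + Real.sin s • infRot i j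

lemma norm_rotMap {i j : Fin d} (hij : i ≠ j) (s : ℝ) (x : EuclideanSpace ℝ (Fin d)) :
    ‖rotMap i j s x‖ = ‖x‖ := by
  have h : ‖rotMap i j s x‖ ^ 2 = ‖x‖ ^ 2 := by
    have hx : rotMap i j s x = x + ((Real.cos s - 1) * x i - Real.sin s * x j) •
        EuclideanSpace.single i (1 : ℝ) +
        ((Real.cos s - 1) * x j + Real.sin s * x i) • EuclideanSpace.single j (1 : ℝ) := by
      simp only [rotMap, add_apply, smul_apply,
        planeProj_apply, infRot_apply, ContinuousLinearMap.id_apply]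
      module
    rw [hx, ← real_inner_self_eq_norm_sq, ← real_inner_self_eq_norm_sq]
    simp only [inner_add_left, inner_add_right, inner_smul_left, inner_smul_right,
      EuclideanSpace.inner_single_left, EuclideanSpace.inner_single_right]
    simp [hij, hij.symm]
    linear_combination ((x i) ^ 2 + (x j) ^ 2) * Real.sin_sq_add_cos_sq s
  exact (sq_eq_sq₀ (norm_nonneg _) (norm_nonneg _)).1 h

/-- Rotation by the angle `s` in the `(i, j)` plane. -/
def rot {i j : Fin d} (hij : i ≠ j) (s : ℝ) :
    EuclideanSpace ℝ (Fin d) ≃ₗᵢ[ℝ] EuclideanSpace ℝ (Fin d) :=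
  LinearIsometry.toLinearIsometryEquiv ⟨(rotMap i j s).toLinearMap, norm_rotMap hij s⟩ rfl

lemma rot_apply {i j : Fin d} (hij : i ≠ j) (s : ℝ) (x : EuclideanSpace ℝ (Fin d)) :
    rot hij s x = x + (Real.cos s - 1) • planeProj i j x + Real.sin s • infRot i j x := rfl

lemma hasDerivAt_rot {i j : Fin d} (hij : i ≠ j) (s : ℝ) (x : EuclideanSpace ℝ (Fin d)) :
    HasDerivAt (fun s => rot hij s x)
      ((-Real.sin s) • planeProj i j x + Real.cos s • infRot i j x) s := by
  simp only [rot_apply]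
  have h1 := ((Real.hasDerivAt_cos s).sub_const 1).smul_const (planeProj i j x)
  have h2 := (Real.hasDerivAt_sin s).smul_const (infRot i j x)
  exact (h1.const_add x).add h2

lemma continuous_fderiv_sphere {F : EuclideanSpace ℝ (Fin d) → ℝ}
    (hF : ∀ x : Sph d, ContDiffAt ℝ 1 F x) : Continuous fun x : Sph d => fderiv ℝ F x := by
  rw [continuous_iff_continuousAt]
  intro x
  exact ((hF x).continuousAt_fderiv (by norm_num)).comp continuousAt_subtype_val

/-- A continuous function on the sphere is integrable. -/
lemma integrable_of_continuous {E : Type*} [NormedAddCommGroup E] [SecondCountableTopology E]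
    {f : Sph d → E} (hf : Continuous f) : Integrable f (normSurface d) := by
  have := isFiniteMeasure_normSurface (d := d)
  obtain ⟨C, hC⟩ := isCompact_univ.exists_bound_of_continuousOn hf.continuousOn
  exact Integrable.of_bound hf.aestronglyMeasurable C (Eventually.of_forall fun x => hC x trivial)

/-- The integral of `F` composed with the rotation by `s` does not depend on `s`; differentiating
under the integral at `s = 0` gives the claim. This is the source of every integration by parts
below. -/
lemma integral_fderiv_infRot {F : EuclideanSpace ℝ (Fin d) → ℝ}
    (hF : ∀ x : Sph d, ContDiffAt ℝ 1 F x) (i j : Fin d) :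
    ∫ x : Sph d, fderiv ℝ F x (infRot i j x) ∂(normSurface d) = 0 := by
  have := isFiniteMeasure_normSurface (d := d)
  by_cases hij : i = j
  · subst hij
    simp [infRot_apply]
  have hcF : Continuous fun x : Sph d => F x := by
    rw [continuous_iff_continuousAt]
    intro x
    exact ContinuousAt.comp (f := ((↑) : Sph d → EuclideanSpace ℝ (Fin d))) (hF x).continuousAt
      continuousAt_subtype_val
  have hc := continuous_fderiv_sphere hF
  obtain ⟨M, hM⟩ := isCompact_univ.exists_bound_of_continuousOn hc.continuousOn
  -- `M` bounds the differential of `F` on the sphere and `K` bounds the velocity of the rotation,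
  -- both uniformly in the angle, so `M * K` is a dominating constant.
  set K := ‖planeProj i j‖ + ‖infRot i j‖
  have hdiff : ∀ (x : Sph d) (s : ℝ), HasDerivAt (fun s => F (rot hij s x))
      (fderiv ℝ F (rot hij s x) ((-Real.sin s) • planeProj i j x + Real.cos s • infRot i j x)) s := by
    intro x s
    have h1 : DifferentiableAt ℝ F (rot hij s x) :=
      (hF (sphMap (rot hij s) x)).differentiableAt (by norm_num)
    exact h1.hasFDerivAt.comp_hasDerivAt s (hasDerivAt_rot hij s x)
  have hrot : ∀ s, Continuous fun x : Sph d => F (rot hij s x) := fun s =>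
    hcF.comp (continuous_sphMap (rot hij s))
  have h := hasDerivAt_integral_of_dominated_loc_of_deriv_le (μ := normSurface d)
    (F := fun s (x : Sph d) => F (rot hij s x)) (x₀ := (0 : ℝ)) (s := univ)
    (F' := fun s x => fderiv ℝ F (rot hij s x)
      ((-Real.sin s) • planeProj i j x + Real.cos s • infRot i j x))
    (bound := fun _ => M * K) univ_mem
    (Eventually.of_forall fun s => (hrot s).aestronglyMeasurable)
    (integrable_of_continuous (hrot 0))
    (by
      have h0 : ∀ x : EuclideanSpace ℝ (Fin d), rot hij 0 x = x := by simp [rot_apply]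
      simp only [h0, Real.sin_zero, Real.cos_zero, neg_zero, zero_smul, one_smul, zero_add]
      exact (hc.clm_apply ((infRot i j).continuous.comp continuous_subtype_val)).aestronglyMeasurable)
    (Eventually.of_forall fun x s _ => by
      refine (ContinuousLinearMap.le_opNorm _ _).trans ?_
      have hx : ‖(x : EuclideanSpace ℝ (Fin d))‖ = 1 := by simp
      have h1 : ‖fderiv ℝ F (rot hij s x)‖ ≤ M := hM (sphMap (rot hij s) x) trivial
      have h2 : ‖(-Real.sin s) • planeProj i j x + Real.cos s • infRot i j x‖ ≤ K := by
        refine (norm_add_le _ _).trans (add_le_add ?_ ?_)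
        · rw [norm_smul, norm_neg]
          have := (planeProj i j).le_opNorm x
          rw [hx, mul_one] at this
          calc _ ≤ 1 * ‖planeProj i j x‖ := by
                gcongr
                exact Real.abs_sin_le_one s
            _ ≤ _ := by rwa [one_mul]
        · rw [norm_smul]
          have := (infRot i j).le_opNorm x
          rw [hx, mul_one] at this
          calc _ ≤ 1 * ‖infRot i j x‖ := by
                gcongr
                exact Real.abs_cos_le_one s
            _ ≤ _ := by rwa [one_mul]
      exact mul_le_mul h1 h2 (norm_nonneg _) ((norm_nonneg _).trans h1))
    (integrable_const _)
    (Eventually.of_forall fun x s _ => hdiff x s)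
  have hconst : (fun s => ∫ x : Sph d, F (rot hij s x) ∂(normSurface d)) =
      fun _ => ∫ x : Sph d, F x ∂(normSurface d) := by
    funext s
    have hmp := measurePreserving_sphMap (rot hij s)
    rw [← hmp.map_eq, integral_map hmp.measurable.aemeasurable hcF.aestronglyMeasurable, hmp.map_eq]
    rfl
  have h2 := h.2
  rw [hconst] at h2
  have h3 := h2.unique (hasDerivAt_const (0 : ℝ) _)
  simpa [rot_apply] using h3

end Rotation

/-! ### Polynomials: angular derivatives and harmonic decomposition -/

section Polynomial

open MvPolynomial

variable {d : ℕ}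

/-- The angular derivative `x_i ∂_j - x_j ∂_i` on polynomials. -/
def angDeriv (i j : Fin d) :
    Derivation ℝ (MvPolynomial (Fin d) ℝ) (MvPolynomial (Fin d) ℝ) :=
  (X i : MvPolynomial (Fin d) ℝ) • pderiv j - (X j : MvPolynomial (Fin d) ℝ) • pderiv i

lemma angDeriv_apply (i j : Fin d) (p : MvPolynomial (Fin d) ℝ) :
    angDeriv i j p = X i * pderiv j p - X j * pderiv i p := rfl

/-- The polynomial `|x|²`. -/
def normSqPoly (d : ℕ) : MvPolynomial (Fin d) ℝ := ∑ i, X i ^ 2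

lemma pderiv_comm (i j : Fin d) (p : MvPolynomial (Fin d) ℝ) :
    pderiv i (pderiv j p) = pderiv j (pderiv i p) := by
  classical
  have h : ⁅(pderiv i : Derivation ℝ (MvPolynomial (Fin d) ℝ) (MvPolynomial (Fin d) ℝ)),
      (pderiv j : Derivation ℝ (MvPolynomial (Fin d) ℝ) (MvPolynomial (Fin d) ℝ))⁆ = 0 := by
    refine MvPolynomial.derivation_ext fun k => ?_
    simp only [Derivation.commutator_apply, pderiv_X, Pi.single_apply]
    split_ifs <;> simp
  have := congrArg (fun D : Derivation ℝ (MvPolynomial (Fin d) ℝ) (MvPolynomial (Fin d) ℝ) => D p) h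
  simpa [Derivation.commutator_apply, sub_eq_zero] using this

lemma pderiv_X_eq (i j : Fin d) :
    pderiv i (X j : MvPolynomial (Fin d) ℝ) = if i = j then 1 else 0 := by
  classical
  rw [pderiv_X, Pi.single_apply]
  simp [eq_comm]

lemma isHomogeneous_sum_X_mul {n : ℕ} {p : MvPolynomial (Fin d) ℝ} (hp : p.IsHomogeneous n) :
    ∑ i, X i * pderiv i p = (n : MvPolynomial (Fin d) ℝ) * p := by
  rw [hp.sum_X_mul_pderiv, nsmul_eq_mul]

lemma sum_X_mul_pderiv_pderiv {n : ℕ} {p : MvPolynomial (Fin d) ℝ} (hp : p.IsHomogeneous n) :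
    ∑ i, X i * ∑ j, X j * pderiv i (pderiv j p) =
      ((n : MvPolynomial (Fin d) ℝ) ^ 2 - (n : MvPolynomial (Fin d) ℝ)) * p := by
  have h1 : ∀ i, ∑ j, X j * pderiv i (pderiv j p) =
      ((n : MvPolynomial (Fin d) ℝ) - 1) * pderiv i p := by
    intro i
    have h := congrArg (pderiv i) (isHomogeneous_sum_X_mul hp)
    rw [map_sum] at h
    simp only [pderiv_mul, pderiv_X_eq, ite_mul, one_mul, zero_mul, Finset.sum_add_distrib,
      Finset.sum_ite_eq, Finset.mem_univ, if_true] at h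
    have h0 : pderiv i (n : MvPolynomial (Fin d) ℝ) = 0 := by simp
    rw [h0] at h
    linear_combination h
  simp_rw [h1]
  have h2 := isHomogeneous_sum_X_mul hp
  calc ∑ i, X i * (((n : MvPolynomial (Fin d) ℝ) - 1) * pderiv i p)
      = ((n : MvPolynomial (Fin d) ℝ) - 1) * ∑ i, X i * pderiv i p := by
        rw [Finset.mul_sum]
        exact Finset.sum_congr rfl fun i _ => by ring
    _ = _ := by rw [h2]; ring

lemma angDeriv_angDeriv (i j : Fin d) (p : MvPolynomial (Fin d) ℝ) :
    angDeriv i j (angDeriv i j p) = X i ^ 2 * pderiv j (pderiv j p) +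
      X j ^ 2 * pderiv i (pderiv i p) - X i * pderiv i p - X j * pderiv j p -
      2 * (X i * (X j * pderiv i (pderiv j p))) +
      (if i = j then X i * pderiv j p + X j * pderiv i p else 0) := by
  simp only [angDeriv_apply, map_sub, pderiv_mul, pderiv_X_eq, pderiv_comm j i]
  by_cases h : i = j
  · subst h; simp; ring
  · simp [h, Ne.symm h]; ring

/-- The sum of the squares of the angular derivatives of a homogeneous polynomial. -/
lemma sum_angDeriv_angDeriv {n : ℕ} {p : MvPolynomial (Fin d) ℝ} (hp : p.IsHomogeneous n) :
    ∑ i, ∑ j, angDeriv i j (angDeriv i j p) =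
      2 * (normSqPoly d * polyLaplacian p -
        (n : MvPolynomial (Fin d) ℝ) * ((n : MvPolynomial (Fin d) ℝ) + d - 2) * p) := by
  simp only [angDeriv_angDeriv, Finset.sum_add_distrib, Finset.sum_sub_distrib,
    Finset.sum_ite_eq, Finset.mem_univ, if_true, Finset.sum_const, Finset.card_univ,
    Fintype.card_fin, nsmul_eq_mul, ← Finset.mul_sum, sum_X_mul_pderiv_pderiv hp,
    isHomogeneous_sum_X_mul hp, ← Finset.sum_mul]
  simp only [normSqPoly, polyLaplacian]
  ring

/-- The two commutator terms `2 ∂_i ∂_j p` cancel. Hence angular derivatives preserve harmonicity.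
-/
lemma polyLaplacian_angDeriv (i j : Fin d) (p : MvPolynomial (Fin d) ℝ) :
    polyLaplacian (angDeriv i j p) = angDeriv i j (polyLaplacian p) := by
  have h : ∀ k, pderiv k (pderiv k (angDeriv i j p)) =
      X i * pderiv j (pderiv k (pderiv k p)) - X j * pderiv i (pderiv k (pderiv k p)) +
      (if k = i then 2 * pderiv k (pderiv j p) else 0) -
      (if k = j then 2 * pderiv k (pderiv i p) else 0) := by
    intro k
    have e1 : ∀ l, pderiv l (pderiv k (pderiv k p)) = pderiv k (pderiv k (pderiv l p)) := by
      intro l; rw [pderiv_comm l k, pderiv_comm l k]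
    rw [e1 i, e1 j]
    simp only [angDeriv_apply, map_sub, map_add, pderiv_mul, pderiv_X_eq]
    have e2 : ∀ l, pderiv k (if k = l then (1 : MvPolynomial (Fin d) ℝ) else 0) = 0 := by
      intro l; split_ifs <;> simp
    rw [e2, e2]
    split_ifs <;> ring
  have h2 : polyLaplacian (angDeriv i j p) = _ := Finset.sum_congr rfl fun k _ => h k
  rw [h2]
  simp only [polyLaplacian, Finset.sum_add_distrib, Finset.sum_sub_distrib, Finset.sum_ite_eq',
    Finset.mem_univ, if_true, ← Finset.mul_sum, angDeriv_apply, map_sum]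
  rw [pderiv_comm i j]
  ring

lemma isHomogeneous_angDeriv {n : ℕ} {p : MvPolynomial (Fin d) ℝ} (hp : p.IsHomogeneous n)
    (i j : Fin d) : (angDeriv i j p).IsHomogeneous n := by
  cases n with
  -- Constants are treated apart: with truncated subtraction, `X k * pderiv l p` would be assigned
  -- degree 1 here.
  | zero =>
    rw [← totalDegree_zero_iff_isHomogeneous, totalDegree_eq_zero_iff_eq_C] at hp
    rw [hp, angDeriv_apply, pderiv_C, pderiv_C]
    simpa using isHomogeneous_zero _ _ _
  | succ n =>
    rw [angDeriv_apply]
    have h : ∀ k l : Fin d, (X k * pderiv l p).IsHomogeneous (n + 1) := fun k l => by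
      rw [add_comm]
      exact (isHomogeneous_X ℝ k).mul hp.pderiv
    exact (h i j).sub (h j i)

lemma polyLaplacian_normSqPoly_mul {n : ℕ} {q : MvPolynomial (Fin d) ℝ} (hq : q.IsHomogeneous n) :
    polyLaplacian (normSqPoly d * q) =
      (2 * (d : MvPolynomial (Fin d) ℝ) + 4 * n) * q + normSqPoly d * polyLaplacian q := by
  have hR : ∀ k, pderiv k (normSqPoly d) = 2 * X k := by
    intro k
    simp only [normSqPoly, map_sum, pow_two, pderiv_mul, pderiv_X_eq]
    simp [Finset.sum_add_distrib]
    ring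
  have h : ∀ k, pderiv k (pderiv k (normSqPoly d * q)) =
      2 * q + 4 * (X k * pderiv k q) + normSqPoly d * pderiv k (pderiv k q) := by
    intro k
    have h0 : pderiv k (2 : MvPolynomial (Fin d) ℝ) = 0 := by
      rw [show (2 : MvPolynomial (Fin d) ℝ) = C 2 from (map_ofNat C 2).symm, pderiv_C]
    simp only [pderiv_mul, map_add, hR]
    rw [h0, pderiv_X_self]
    ring
  simp only [polyLaplacian, h, Finset.sum_add_distrib, ← Finset.mul_sum, Finset.sum_const,
    Finset.card_univ, Fintype.card_fin, nsmul_eq_mul, isHomogeneous_sum_X_mul hq]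
  ring

lemma isHomogeneous_polyLaplacian {n : ℕ} {p : MvPolynomial (Fin d) ℝ} (hp : p.IsHomogeneous n) :
    (polyLaplacian p).IsHomogeneous (n - 1 - 1) :=
  IsHomogeneous.sum _ _ _ fun _ _ => hp.pderiv.pderiv

lemma isHomogeneous_normSqPoly_mul {n : ℕ} {p : MvPolynomial (Fin d) ℝ}
    (hp : p.IsHomogeneous n) : (normSqPoly d * p).IsHomogeneous (n + 2) := by
  rw [add_comm]
  exact (IsHomogeneous.sum _ _ _ fun i _ => by simpa using (isHomogeneous_X ℝ i).pow 2).mul hp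

lemma polyLaplacian_sub (p q : MvPolynomial (Fin d) ℝ) :
    polyLaplacian (p - q) = polyLaplacian p - polyLaplacian q := by
  simp [polyLaplacian]

lemma polyLaplacian_C_mul (c : ℝ) (p : MvPolynomial (Fin d) ℝ) :
    polyLaplacian (C c * p) = C c * polyLaplacian p := by
  simp [polyLaplacian, Finset.mul_sum]

/-- Solvability of `c q + |x|² Δ q = r` among homogeneous polynomials, for `c > 0`. -/
lemma exists_C_mul_add_normSqPoly_mul : ∀ (n : ℕ) {c : ℝ}, 0 < c →
    ∀ {r : MvPolynomial (Fin d) ℝ}, r.IsHomogeneous n →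
    ∃ q : MvPolynomial (Fin d) ℝ, q.IsHomogeneous n ∧
      C c * q + normSqPoly d * polyLaplacian q = r := by
  intro n
  induction n using Nat.strong_induction_on with
  | _ n ih =>
  intro c hc r hr
  have hcc : (C c * C c⁻¹ : MvPolynomial (Fin d) ℝ) = 1 := by
    rw [← C_mul, mul_inv_cancel₀ hc.ne', C_1]
  have hhom : ∀ {m} {a : ℝ} {q : MvPolynomial (Fin d) ℝ}, q.IsHomogeneous m →
      (C a * q).IsHomogeneous m := fun {m a q} h => by
    simpa using (isHomogeneous_C (Fin d) a).mul h
  rcases Nat.lt_or_ge n 2 with hn | hn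
  · refine ⟨C c⁻¹ * r, hhom hr, ?_⟩
    have h0 : polyLaplacian r = 0 := by
      refine Finset.sum_eq_zero fun i _ => ?_
      have h1 : (pderiv i r).IsHomogeneous 0 := by
        have := hr.pderiv (i := i)
        rwa [show n - 1 = 0 by omega] at this
      rw [← totalDegree_zero_iff_isHomogeneous, totalDegree_eq_zero_iff_eq_C] at h1
      rw [h1, pderiv_C]
    rw [polyLaplacian_C_mul, h0]
    linear_combination r * hcc
  · obtain ⟨m, rfl⟩ := Nat.exists_eq_add_of_le' hn
    -- Here `s` plays the role of the Laplacian of `q`. Applying the Laplacian to `c q + |x|² s = r`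
    -- gives the same kind of equation for `s`, two degrees lower, with the constant raised by `2 d
    -- + 4 m`.
    obtain ⟨s, hs, hs'⟩ := ih m (by omega) (c := 2 * d + 4 * m + c) (by positivity)
      (r := polyLaplacian r) (by simpa using isHomogeneous_polyLaplacian hr)
    refine ⟨C c⁻¹ * (r - normSqPoly d * s), hhom (hr.sub (isHomogeneous_normSqPoly_mul hs)), ?_⟩
    rw [polyLaplacian_C_mul, polyLaplacian_sub, polyLaplacian_normSqPoly_mul hs, ← hs']
    simp only [map_add, map_mul, map_natCast, map_ofNat]
    linear_combination r * hcc

/-- A homogeneous polynomial is, up to a multiple of `|x|²`, harmonic. -/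
lemma exists_harmonic_decomposition {n : ℕ} {p : MvPolynomial (Fin d) ℝ} (hd : 2 ≤ d)
    (hp : p.IsHomogeneous (n + 2)) :
    ∃ q : MvPolynomial (Fin d) ℝ, q.IsHomogeneous n ∧
      polyLaplacian (p - normSqPoly d * q) = 0 := by
  have hd' : (0 : ℝ) < d := by exact_mod_cast (by omega : 0 < d)
  -- By `polyLaplacian_normSqPoly_mul`, harmonicity of `p - |x|² q` is exactly this equation, with
  -- right-hand side the Laplacian of `p`.
  obtain ⟨q, hq, hq'⟩ := exists_C_mul_add_normSqPoly_mul n (c := 2 * d + 4 * n)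
    (by positivity) (r := polyLaplacian p) (by simpa using isHomogeneous_polyLaplacian hp)
  refine ⟨q, hq, ?_⟩
  rw [polyLaplacian_sub, polyLaplacian_normSqPoly_mul hq, ← hq']
  simp only [map_add, map_mul, map_natCast, map_ofNat]
  ring

end Polynomial

/-! ### Polynomials restricted to the sphere -/

section Restrict

open MvPolynomial

variable {d : ℕ}

lemma restrict_add (p q : MvPolynomial (Fin d) ℝ) (x : Sph d) :
    restrict (p + q) x = restrict p x + restrict q x := by simp [restrict]

lemma restrict_sub (p q : MvPolynomial (Fin d) ℝ) (x : Sph d) :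
    restrict (p - q) x = restrict p x - restrict q x := by simp [restrict]

lemma restrict_mul (p q : MvPolynomial (Fin d) ℝ) (x : Sph d) :
    restrict (p * q) x = restrict p x * restrict q x := by simp [restrict]

lemma restrict_C (c : ℝ) (x : Sph d) : restrict (C c) x = c := by simp [restrict]

lemma restrict_smul (c : ℝ) (p : MvPolynomial (Fin d) ℝ) (x : Sph d) :
    restrict (c • p) x = c * restrict p x := by simp [restrict]

lemma restrict_sum {ι : Type*} (s : Finset ι) (p : ι → MvPolynomial (Fin d) ℝ) (x : Sph d) :
    restrict (∑ k ∈ s, p k) x = ∑ k ∈ s, restrict (p k) x := by simp [restrict]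

lemma sum_sq_sph (x : Sph d) : ∑ i, (x : EuclideanSpace ℝ (Fin d)) i ^ 2 = 1 := by
  have h : ‖(x : EuclideanSpace ℝ (Fin d))‖ = 1 := by simp
  rw [EuclideanSpace.norm_eq, Real.sqrt_eq_one] at h
  simpa using h

lemma restrict_normSqPoly (x : Sph d) : restrict (normSqPoly d) x = 1 := by
  simp [restrict, normSqPoly, sum_sq_sph]

lemma continuous_restrict (p : MvPolynomial (Fin d) ℝ) : Continuous (restrict p : Sph d → ℝ) := by
  refine (MvPolynomial.continuous_eval p).comp (continuous_pi fun i => ?_)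
  fun_prop

/-- The polynomial as a function on the Euclidean space. -/
def polyFun (p : MvPolynomial (Fin d) ℝ) (y : EuclideanSpace ℝ (Fin d)) : ℝ :=
  eval (fun i => y i) p

lemma hasFDerivAt_polyFun (p : MvPolynomial (Fin d) ℝ) (y : EuclideanSpace ℝ (Fin d)) :
    HasFDerivAt (polyFun p)
      (∑ i, polyFun (pderiv i p) y • (EuclideanSpace.proj i : EuclideanSpace ℝ (Fin d) →L[ℝ] ℝ))
      y := by
  induction p using MvPolynomial.induction_on with
  | C a =>
    have : polyFun (C a : MvPolynomial (Fin d) ℝ) = fun _ => a := by funext z; simp [polyFun]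
    rw [this]
    simpa [polyFun] using hasFDerivAt_const a y
  | add p q hp hq =>
    have : polyFun (p + q) = fun z => polyFun p z + polyFun q z := by funext z; simp [polyFun]
    rw [this]
    refine (hp.add hq).congr_fderiv ?_
    rw [← Finset.sum_add_distrib]
    refine Finset.sum_congr rfl fun i _ => ?_
    simp [polyFun, add_smul]
  | mul_X p j hp =>
    have : polyFun (p * X j) = fun z => polyFun p z *
        (EuclideanSpace.proj j : EuclideanSpace ℝ (Fin d) →L[ℝ] ℝ) z := by
      funext z; simp [polyFun]
    rw [this]
    refine (hp.mul (ContinuousLinearMap.hasFDerivAt _)).congr_fderiv ?_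
    ext v
    simp only [polyFun, pderiv_mul, pderiv_X_eq, map_add, map_mul, eval_X, add_apply, smul_apply,
      sum_apply, smul_eq_mul, add_mul, Finset.sum_add_distrib, Finset.mul_sum]
    rw [add_comm]
    congr 1
    · exact Finset.sum_congr rfl fun i _ => by simp only [PiLp.proj_apply]; ring
    · simp [apply_ite]

lemma contDiff_polyFun (p : MvPolynomial (Fin d) ℝ) : ContDiff ℝ 1 (polyFun p) := by
  rw [contDiff_one_iff_fderiv]
  refine ⟨fun y => (hasFDerivAt_polyFun p y).differentiableAt, ?_⟩
  have : fderiv ℝ (polyFun p) = fun y => ∑ i, polyFun (pderiv i p) y •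
      (EuclideanSpace.proj i : EuclideanSpace ℝ (Fin d) →L[ℝ] ℝ) :=
    funext fun y => (hasFDerivAt_polyFun p y).fderiv
  rw [this]
  refine continuous_finsetSum _ fun i _ => Continuous.smul (f := polyFun (pderiv i p)) ?_ continuous_const
  refine (MvPolynomial.continuous_eval _).comp (continuous_pi fun i => ?_)
  fun_prop

lemma fderiv_polyFun_infRot (p : MvPolynomial (Fin d) ℝ) (i j : Fin d) (x : Sph d) :
    fderiv ℝ (polyFun p) x (infRot i j x) = restrict (angDeriv i j p) x := by
  rw [(hasFDerivAt_polyFun p x).fderiv]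
  simp [infRot_apply, restrict, angDeriv_apply, polyFun, mul_sub, Finset.sum_sub_distrib, PiLp.single_apply]
  ring

/-- Integration by parts for a function of class `C¹` near the sphere and a polynomial. -/
lemma integral_fderiv_infRot_mul {F : EuclideanSpace ℝ (Fin d) → ℝ}
    (hF : ∀ x : Sph d, ContDiffAt ℝ 1 F x) (p : MvPolynomial (Fin d) ℝ) (i j : Fin d) :
    ∫ x : Sph d, fderiv ℝ F x (infRot i j x) * restrict p x ∂(normSurface d) =
      - ∫ x : Sph d, F x * restrict (angDeriv i j p) x ∂(normSurface d) := by
  have hp := fun x : Sph d => (contDiff_polyFun p).contDiffAt (x := (x : EuclideanSpace ℝ (Fin d)))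
  have h := integral_fderiv_infRot (F := fun y => F y * polyFun p y)
    (fun x => (hF x).mul (hp x)) i j
  have hc : Continuous fun x : Sph d => F x := continuous_iff_continuousAt.2 fun x =>
    ContinuousAt.comp (f := ((↑) : Sph d → EuclideanSpace ℝ (Fin d))) (hF x).continuousAt
      continuousAt_subtype_val
  rw [eq_neg_iff_add_eq_zero, ← integral_add]
  · rw [← h]
    refine integral_congr_ae (Filter.Eventually.of_forall fun x => ?_)
    have e := fderiv_fun_mul ((hF x).differentiableAt (by norm_num))
      ((hp x).differentiableAt (by norm_num))
    simp only [e, add_apply, smul_apply, fderiv_polyFun_infRot, smul_eq_mul]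
    rw [show polyFun p x = restrict p x from rfl]
    ring
  · exact integrable_of_continuous (((continuous_fderiv_sphere hF).clm_apply
      ((infRot i j).continuous.comp continuous_subtype_val)).mul (continuous_restrict p))
  · exact integrable_of_continuous (hc.mul (continuous_restrict _))

lemma integral_angDeriv_mul (p q : MvPolynomial (Fin d) ℝ) (i j : Fin d) :
    ∫ x : Sph d, restrict (angDeriv i j p) x * restrict q x ∂(normSurface d) =
      - ∫ x : Sph d, restrict p x * restrict (angDeriv i j q) x ∂(normSurface d) := by
  have h := integral_fderiv_infRot_mul (F := polyFun p)
    (fun x => (contDiff_polyFun p).contDiffAt) q i j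
  simp only [fderiv_polyFun_infRot] at h
  exact h

end Restrict

/-! ### The square-integrable functions on the sphere and spherical harmonics -/

section Harmonic

open MvPolynomial Filter Topology

variable {d : ℕ}

instance instIsFiniteMeasureNormSurface : IsFiniteMeasure (normSurface d) :=
  isFiniteMeasure_normSurface

lemma memLp_of_continuous {f : Sph d → ℝ} (hf : Continuous f) : MemLp f 2 (normSurface d) := by
  obtain ⟨C, hC⟩ := isCompact_univ.exists_bound_of_continuousOn hf.continuousOn
  exact MemLp.of_bound hf.aestronglyMeasurable C (Eventually.of_forall fun x => hC x trivial)

lemma memLp_restrict (p : MvPolynomial (Fin d) ℝ) : MemLp (restrict p) 2 (normSurface d) :=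
  memLp_of_continuous (continuous_restrict p)

lemma inner_toLp {f g : Sph d → ℝ} (hf : MemLp f 2 (normSurface d))
    (hg : MemLp g 2 (normSurface d)) :
    inner ℝ (hf.toLp f) (hg.toLp g) = ∫ x, f x * g x ∂(normSurface d) := by
  rw [L2.inner_def]
  refine integral_congr_ae ?_
  filter_upwards [hf.coeFn_toLp, hg.coeFn_toLp] with x h1 h2
  rw [h1, h2]
  simp [mul_comm]

lemma integral_mul_sq_le {f g : Sph d → ℝ} (hf : MemLp f 2 (normSurface d))
    (hg : MemLp g 2 (normSurface d)) :
    (∫ x, f x * g x ∂(normSurface d)) ^ 2 ≤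
      (∫ x, f x ^ 2 ∂(normSurface d)) * ∫ x, g x ^ 2 ∂(normSurface d) := by
  have h := real_inner_mul_inner_self_le (hf.toLp f) (hg.toLp g)
  rw [inner_toLp, inner_toLp, inner_toLp] at h
  simpa only [pow_two] using h

/-- The restriction of a polynomial to the sphere, as an element of `L²`. -/
def polyLp : MvPolynomial (Fin d) ℝ →ₗ[ℝ] Lp ℝ 2 (normSurface d) where
  toFun p := (memLp_restrict p).toLp (restrict p)
  map_add' p q := by
    rw [← MemLp.toLp_add]
    congr 1
    funext x
    exact restrict_add p q x
  map_smul' c p := by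
    rw [RingHom.id_apply, ← MemLp.toLp_const_smul]
    congr 1
    funext x
    exact restrict_smul c p x

/-- The space of homogeneous harmonic polynomials of degree `n`. -/
def harmSub (d n : ℕ) : Submodule ℝ (MvPolynomial (Fin d) ℝ) where
  carrier := {p | p.IsHomogeneous n ∧ polyLaplacian p = 0}
  add_mem' {p q} hp hq := by
    refine ⟨hp.1.add hq.1, ?_⟩
    have h : polyLaplacian (p + q) = polyLaplacian p + polyLaplacian q := by
      simp [polyLaplacian, Finset.sum_add_distrib]
    rw [h, hp.2, hq.2, add_zero]
  zero_mem' := ⟨isHomogeneous_zero _ _ _, by simp [polyLaplacian]⟩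
  smul_mem' c p hp := by
    refine ⟨(homogeneousSubmodule (Fin d) ℝ n).smul_mem c hp.1, ?_⟩
    rw [smul_eq_C_mul, polyLaplacian_C_mul, hp.2, mul_zero]

lemma mem_harmSub {n : ℕ} {p : MvPolynomial (Fin d) ℝ} :
    p ∈ harmSub d n ↔ p.IsHomogeneous n ∧ polyLaplacian p = 0 := Iff.rfl

lemma angDeriv_mem_harmSub {n : ℕ} {p : MvPolynomial (Fin d) ℝ} (hp : p ∈ harmSub d n)
    (i j : Fin d) : angDeriv i j p ∈ harmSub d n :=
  ⟨isHomogeneous_angDeriv hp.1 i j, by rw [polyLaplacian_angDeriv, hp.2, map_zero]⟩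

instance instFiniteDimensionalHarmSub (n : ℕ) : FiniteDimensional ℝ (harmSub d n) := by
  have : FiniteDimensional ℝ (homogeneousSubmodule (Fin d) ℝ n) :=
    Module.Finite.iff_fg.2 (homogeneousSubmodule_fg (Fin d) ℝ n)
  exact Submodule.finiteDimensional_of_le (S₂ := homogeneousSubmodule (Fin d) ℝ n) fun p hp => hp.1

/-- The eigenvalue `n (n + d - 2)` of the Laplace-Beltrami operator. -/
def sphEigen (d n : ℕ) : ℝ := (n : ℝ) * ((n : ℝ) + (d : ℝ) - 2)

lemma sphEigen_strictMono (hd : 2 ≤ d) : StrictMono (sphEigen d) := by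
  intro m n h
  have h1 : (m : ℝ) < n := by exact_mod_cast h
  have h2 : (0 : ℝ) ≤ m := by positivity
  have h3 : (2 : ℝ) ≤ d := by exact_mod_cast hd
  unfold sphEigen
  nlinarith [mul_nonneg (sub_nonneg.2 h1.le) (sub_nonneg.2 h3)]

lemma sphEigen_zero : sphEigen d 0 = 0 := by simp [sphEigen]

lemma sphEigen_nonneg (hd : 2 ≤ d) (n : ℕ) : 0 ≤ sphEigen d n := by
  rw [← sphEigen_zero (d := d)]
  exact (sphEigen_strictMono hd).monotone (Nat.zero_le n)

lemma sum_restrict_angDeriv_angDeriv {n : ℕ} {p : MvPolynomial (Fin d) ℝ}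
    (hp : p ∈ harmSub d n) (x : Sph d) :
    ∑ i, ∑ j, restrict (angDeriv i j (angDeriv i j p)) x = -2 * sphEigen d n * restrict p x := by
  have h := congrArg (fun q => restrict q x) (sum_angDeriv_angDeriv hp.1)
  simp only [restrict_sum, hp.2] at h
  rw [h]
  simp [restrict, sphEigen]
  ring

lemma integral_angDeriv_angDeriv_mul (p q : MvPolynomial (Fin d) ℝ) (i j : Fin d) :
    ∫ x : Sph d, restrict (angDeriv i j (angDeriv i j p)) x * restrict q x ∂(normSurface d) =
      ∫ x : Sph d, restrict p x * restrict (angDeriv i j (angDeriv i j q)) x ∂(normSurface d) := by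
  rw [integral_angDeriv_mul, integral_angDeriv_mul, neg_neg]

lemma integrable_restrict_mul (p q : MvPolynomial (Fin d) ℝ) :
    Integrable (fun x : Sph d => restrict p x * restrict q x) (normSurface d) :=
  integrable_of_continuous ((continuous_restrict p).mul (continuous_restrict q))

/-- The sum of the `D_ij²` is a symmetric operator, and the two functions are eigenvectors with
different eigenvalues. -/
lemma integral_harmonic_mul_eq_zero (hd : 2 ≤ d) {m n : ℕ} (hmn : m ≠ n)
    {p q : MvPolynomial (Fin d) ℝ} (hp : p ∈ harmSub d m) (hq : q ∈ harmSub d n) :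
    ∫ x : Sph d, restrict p x * restrict q x ∂(normSurface d) = 0 := by
  have h : ∑ i, ∑ j, ∫ x : Sph d,
      restrict (angDeriv i j (angDeriv i j p)) x * restrict q x ∂(normSurface d) =
      ∑ i, ∑ j, ∫ x : Sph d,
      restrict p x * restrict (angDeriv i j (angDeriv i j q)) x ∂(normSurface d) :=
    Finset.sum_congr rfl fun i _ => Finset.sum_congr rfl fun j _ =>
      integral_angDeriv_angDeriv_mul p q i j
  have e1 : ∑ i, ∑ j, ∫ x : Sph d,
      restrict (angDeriv i j (angDeriv i j p)) x * restrict q x ∂(normSurface d) =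
      -2 * sphEigen d m * ∫ x : Sph d, restrict p x * restrict q x ∂(normSurface d) := by
    simp_rw [← integral_finsetSum _ fun i _ => integrable_restrict_mul _ q]
    rw [← integral_finsetSum _ fun i _ => integrable_finsetSum _ fun j _ =>
      integrable_restrict_mul _ q, ← integral_const_mul]
    refine integral_congr_ae (Eventually.of_forall fun x => ?_)
    simp only [← Finset.sum_mul, sum_restrict_angDeriv_angDeriv hp]
    ring
  have e2 : ∑ i, ∑ j, ∫ x : Sph d,
      restrict p x * restrict (angDeriv i j (angDeriv i j q)) x ∂(normSurface d) =
      -2 * sphEigen d n * ∫ x : Sph d, restrict p x * restrict q x ∂(normSurface d) := by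
    simp_rw [← integral_finsetSum _ fun i _ => integrable_restrict_mul p _]
    rw [← integral_finsetSum _ fun i _ => integrable_finsetSum _ fun j _ =>
      integrable_restrict_mul p _, ← integral_const_mul]
    refine integral_congr_ae (Eventually.of_forall fun x => ?_)
    simp only [← Finset.mul_sum, sum_restrict_angDeriv_angDeriv hq]
    ring
  rw [e1, e2] at h
  have h2 : (sphEigen d m - sphEigen d n) *
      ∫ x : Sph d, restrict p x * restrict q x ∂(normSurface d) = 0 := by linear_combination -h / 2
  exact (mul_eq_zero.1 h2).resolve_left (sub_ne_zero.2 fun h => hmn ((sphEigen_strictMono hd).injective h))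

/-- Spherical harmonics of degree `n`, as a subspace of `L²`. -/
def harmLp (d n : ℕ) : Submodule ℝ (Lp ℝ 2 (normSurface d)) := (harmSub d n).map polyLp

lemma orthogonalFamily_harmLp (hd : 2 ≤ d) :
    OrthogonalFamily ℝ (fun n => harmLp d n) fun n => (harmLp d n).subtypeₗᵢ := by
  rintro m n hmn ⟨_, p, hp, rfl⟩ ⟨_, q, hq, rfl⟩
  exact (inner_toLp (memLp_restrict p) (memLp_restrict q)).trans
    (integral_harmonic_mul_eq_zero hd hmn hp hq)

lemma restrict_normSqPoly_mul (q : MvPolynomial (Fin d) ℝ) :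
    (restrict (normSqPoly d * q) : Sph d → ℝ) = restrict q := by
  funext x
  rw [restrict_mul, restrict_normSqPoly, one_mul]

lemma polyLp_congr {p q : MvPolynomial (Fin d) ℝ}
    (h : (restrict p : Sph d → ℝ) = restrict q) : polyLp p = polyLp q := by
  change (memLp_restrict p).toLp (restrict p) = (memLp_restrict q).toLp (restrict q)
  congr 1

/-- On the sphere `|x|² = 1`, so the decomposition `p = (p - |x|² s) + |x|² s` replaces a
homogeneous polynomial by a harmonic one plus one of degree lower by two; induct on the degree. -/
lemma polyLp_mem_iSup_harmLp (hd : 2 ≤ d) (p : MvPolynomial (Fin d) ℝ) :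
    polyLp p ∈ ⨆ n, harmLp d n := by
  have hhom : ∀ (n : ℕ) (q : MvPolynomial (Fin d) ℝ), q.IsHomogeneous n →
      polyLp q ∈ ⨆ n, harmLp d n := by
    intro n
    induction n using Nat.strong_induction_on with
    | _ n ih =>
    intro q hq
    rcases Nat.lt_or_ge n 2 with hn | hn
    · refine Submodule.mem_iSup_of_mem n ⟨q, ⟨hq, ?_⟩, rfl⟩
      refine Finset.sum_eq_zero fun i _ => ?_
      have h1 : (pderiv i q).IsHomogeneous 0 := by
        have := hq.pderiv (i := i)
        rwa [show n - 1 = 0 by omega] at this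
      rw [← totalDegree_zero_iff_isHomogeneous, totalDegree_eq_zero_iff_eq_C] at h1
      rw [h1, pderiv_C]
    · obtain ⟨m, rfl⟩ := Nat.exists_eq_add_of_le' hn
      obtain ⟨s, hs, hs'⟩ := exists_harmonic_decomposition hd hq
      have h1 : polyLp q = polyLp (q - normSqPoly d * s) + polyLp s := by
        rw [map_sub, polyLp_congr (restrict_normSqPoly_mul s), sub_add_cancel]
      rw [h1]
      refine Submodule.add_mem _ (Submodule.mem_iSup_of_mem (m + 2) ⟨_, ⟨?_, hs'⟩, rfl⟩)
        (ih m (by omega) s hs)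
      exact hq.sub (isHomogeneous_normSqPoly_mul hs)
  rw [← p.sum_homogeneousComponent, map_sum]
  exact Submodule.sum_mem _ fun n _ => hhom n _ (homogeneousComponent_isHomogeneous n p)

/-- The coordinate functions on the sphere. -/
def coordMap (i : Fin d) : C(Sph d, ℝ) :=
  ⟨fun x => (x : EuclideanSpace ℝ (Fin d)) i, by fun_prop⟩

lemma aeval_coordMap_apply (p : MvPolynomial (Fin d) ℝ) (x : Sph d) :
    aeval (coordMap (d := d)) p x = restrict p x := by
  induction p using MvPolynomial.induction_on with
  | C a => simp [restrict_C]
  | add p q hp hq => rw [map_add, ContinuousMap.add_apply, hp, hq, restrict_add]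
  | mul_X p j hp =>
    rw [map_mul, ContinuousMap.mul_apply, hp, restrict_mul, aeval_X]
    simp [restrict, coordMap]

/-- Polynomials are uniformly dense in the continuous functions by Stone-Weierstrass, as the
coordinates separate points, and continuous functions are dense in `L²`. -/
lemma eq_zero_of_inner_polyLp {h : Lp ℝ 2 (normSurface d)}
    (hh : ∀ p : MvPolynomial (Fin d) ℝ, inner ℝ (polyLp p) h = 0) : h = 0 := by
  set T := ContinuousMap.toLp (E := ℝ) 2 (normSurface d) ℝ
  have hdense : (aeval (R := ℝ) (coordMap (d := d))).range.topologicalClosure = ⊤ := by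
    apply ContinuousMap.subalgebra_topologicalClosure_eq_top_of_separatesPoints
    intro x y hxy
    by_contra hcon
    apply hxy
    apply Subtype.ext
    ext i
    by_contra hne
    exact hcon ⟨_, ⟨coordMap i, ⟨X i, by simp⟩, rfl⟩, hne⟩
  have h1 : ∀ f : C(Sph d, ℝ), inner ℝ (T f) h = 0 := by
    intro f
    have hf : f ∈ (aeval (R := ℝ) (coordMap (d := d))).range.topologicalClosure := by
      rw [hdense]; trivial
    have hcl : IsClosed {f : C(Sph d, ℝ) | inner ℝ (T f) h = 0} :=
      isClosed_eq (T.continuous.inner continuous_const) continuous_const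
    refine closure_minimal ?_ hcl hf
    rintro _ ⟨p, rfl⟩
    have : T (aeval (coordMap (d := d)) p) = polyLp p := by
      apply Lp.ext
      refine (ContinuousMap.coeFn_toLp _ _).trans (EventuallyEq.trans ?_
        (MemLp.coeFn_toLp (memLp_restrict p)).symm)
      exact Eventually.of_forall fun x => aeval_coordMap_apply p x
    exact (congrArg (fun z => inner ℝ z h) this).trans (hh p)
  have h2 : DenseRange T := ContinuousMap.toLp_denseRange ℝ (normSurface d) ℝ (by norm_num)
  have h3 : inner ℝ h h = 0 :=
    h2.induction_on (p := fun z => inner ℝ z h = 0) h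
      (isClosed_eq (continuous_id.inner continuous_const) continuous_const) h1
  exact inner_self_eq_zero.1 h3

variable (d) in
/-- An orthonormal basis of `L²` of the sphere that consists of spherical harmonics. -/
structure HarmonicBasis where
  /-- The index type. -/
  ι : Type
  /-- The degree. -/
  deg : ι → ℕ
  finite_deg : ∀ n, {k | deg k = n}.Finite
  /-- The harmonic polynomials. -/
  poly : ι → MvPolynomial (Fin d) ℝ
  mem_harmSub : ∀ k, poly k ∈ harmSub d (deg k)
  /-- The Hilbert basis. -/
  basis : HilbertBasis ι ℝ (Lp ℝ 2 (normSurface d))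
  basis_eq : ∀ k, basis k = polyLp (poly k)

lemma nonempty_harmonicBasis (hd : 2 ≤ d) : Nonempty (HarmonicBasis d) := by
  have hfin : ∀ n, FiniteDimensional ℝ (harmLp d n) := fun n => by
    unfold harmLp; infer_instance
  let v : ∀ n, OrthonormalBasis (Fin (Module.finrank ℝ (harmLp d n))) ℝ (harmLp d n) := fun n =>
    stdOrthonormalBasis ℝ (harmLp d n)
  have hv := (orthogonalFamily_harmLp hd).orthonormal_sigma_orthonormal
    (v_family := fun n => v n) fun n => (v n).orthonormal
  have hpoly : ∀ k : Σ n, Fin (Module.finrank ℝ (harmLp d n)),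
      ∃ p ∈ harmSub d k.1, polyLp p = (v k.1 k.2 : Lp ℝ 2 (normSurface d)) := fun k =>
    (v k.1 k.2).2
  choose p hp hp' using hpoly
  refine ⟨⟨_, Sigma.fst, fun n => ?_, p, hp, HilbertBasis.mkOfOrthogonalEqBot hv ?_, fun k => ?_⟩⟩
  · refine (Set.finite_range fun i : Fin (Module.finrank ℝ (harmLp d n)) =>
      (⟨n, i⟩ : Σ n, Fin (Module.finrank ℝ (harmLp d n)))).subset ?_
    rintro ⟨m, i⟩ rfl
    exact ⟨i, rfl⟩
  · rw [Submodule.eq_bot_iff]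
    intro h hh
    refine eq_zero_of_inner_polyLp fun q => ?_
    suffices hle : ⨆ n, harmLp d n ≤ (Submodule.span ℝ {h})ᗮ by
      have := hle (polyLp_mem_iSup_harmLp hd q)
      rw [Submodule.mem_orthogonal_singleton_iff_inner_left] at this
      exact this
    refine iSup_le fun n z hz => ?_
    rw [Submodule.mem_orthogonal_singleton_iff_inner_left]
    have hz' : z = ∑ i, (v n).repr ⟨z, hz⟩ i • ((v n i : harmLp d n) : Lp ℝ 2 (normSurface d)) := by
      have := congrArg (Submodule.subtype _) ((v n).sum_repr ⟨z, hz⟩)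
      rw [map_sum] at this
      exact this.symm
    rw [hz', sum_inner]
    refine Finset.sum_eq_zero fun i _ => ?_
    have h0 : inner ℝ ((v n i : harmLp d n) : Lp ℝ 2 (normSurface d)) h = 0 :=
      (Submodule.mem_orthogonal _ _).1 hh _ (Submodule.subset_span ⟨⟨n, i⟩, rfl⟩)
    rw [inner_smul_left, h0, mul_zero]
  · rw [HilbertBasis.coe_mkOfOrthogonalEqBot, hp']
    rfl

end Harmonic

/-! ### Expansion in spherical harmonics -/

namespace HarmonicBasis

open MvPolynomial Filter Topology

variable {d : ℕ} (B : HarmonicBasis d)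

/-- The coefficients of a function in a basis of spherical harmonics. -/
def coef (f : Sph d → ℝ) (k : B.ι) : ℝ := ∫ x, restrict (B.poly k) x * f x ∂(normSurface d)

lemma inner_basis {f : Sph d → ℝ} (hf : MemLp f 2 (normSurface d)) (k : B.ι) :
    inner ℝ (B.basis k) (hf.toLp f) = B.coef f k := by
  rw [B.basis_eq]
  exact inner_toLp (memLp_restrict _) hf

/-- Parseval's identity. -/
lemma hasSum_coef_mul {f g : Sph d → ℝ} (hf : MemLp f 2 (normSurface d))
    (hg : MemLp g 2 (normSurface d)) :
    HasSum (fun k => B.coef f k * B.coef g k) (∫ x, f x * g x ∂(normSurface d)) := by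
  have h := B.basis.hasSum_inner_mul_inner (hf.toLp f) (hg.toLp g)
  rw [inner_toLp] at h
  simpa only [real_inner_comm _ (hf.toLp f), inner_basis] using h

lemma hasSum_coef_sq {f : Sph d → ℝ} (hf : MemLp f 2 (normSurface d)) :
    HasSum (fun k => B.coef f k ^ 2) (∫ x, f x ^ 2 ∂(normSurface d)) := by
  simpa only [pow_two] using B.hasSum_coef_mul hf hf

lemma coef_restrict_eq_zero (hd : 2 ≤ d) {n : ℕ} {p : MvPolynomial (Fin d) ℝ}
    (hp : p ∈ harmSub d n) {k : B.ι} (hk : B.deg k ≠ n) : B.coef (restrict p) k = 0 :=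
  integral_harmonic_mul_eq_zero hd hk (B.mem_harmSub k) hp

open Classical in
lemma coef_poly (k l : B.ι) : B.coef (restrict (B.poly l)) k = if k = l then 1 else 0 := by
  have h := orthonormal_iff_ite.1 B.basis.orthonormal k l
  rw [B.basis_eq l] at h
  rw [← h]
  exact (B.inner_basis (memLp_restrict _) k).symm

/-- A finite linear combination of the basis polynomials. -/
def comb (a : B.ι → ℝ) (S : Finset B.ι) : MvPolynomial (Fin d) ℝ := ∑ k ∈ S, a k • B.poly k

lemma restrict_comb (a : B.ι → ℝ) (S : Finset B.ι) (x : Sph d) :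
    restrict (B.comb a S) x = ∑ k ∈ S, a k * restrict (B.poly k) x := by
  simp only [comb, restrict_sum, restrict_smul]

lemma integral_comb_mul (a : B.ι → ℝ) (S : Finset B.ι) {f : Sph d → ℝ}
    (hf : MemLp f 2 (normSurface d)) :
    ∫ x, restrict (B.comb a S) x * f x ∂(normSurface d) = ∑ k ∈ S, a k * B.coef f k := by
  simp only [restrict_comb, Finset.sum_mul, mul_assoc]
  rw [integral_finsetSum]
  · simp only [integral_const_mul, coef]
  · exact fun k _ => ((memLp_restrict (B.poly k)).integrable_mul hf).const_mul (a k)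

open Classical in
lemma coef_comb (a : B.ι → ℝ) (S : Finset B.ι) (k : B.ι) :
    B.coef (restrict (B.comb a S)) k = if k ∈ S then a k else 0 := by
  have h := B.integral_comb_mul a S (memLp_restrict (B.poly k))
  have h2 : B.coef (restrict (B.comb a S)) k =
      ∫ x, restrict (B.comb a S) x * restrict (B.poly k) x ∂(normSurface d) := by
    simp only [coef, mul_comm]
  rw [h2, h]
  simp [coef_poly]

lemma integral_comb_mul_comb (a b : B.ι → ℝ) (S : Finset B.ι) :
    ∫ x, restrict (B.comb a S) x * restrict (B.comb b S) x ∂(normSurface d) =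
      ∑ k ∈ S, a k * b k := by
  classical
  rw [B.integral_comb_mul a S (memLp_restrict _)]
  refine Finset.sum_congr rfl fun k hk => ?_
  rw [coef_comb, if_pos hk]

/-- The Dirichlet form of a finite combination of spherical harmonics. -/
lemma sum_integral_angDeriv_comb_sq (a : B.ι → ℝ) (S : Finset B.ι) :
    ∑ i, ∑ j, ∫ x, restrict (angDeriv i j (B.comb a S)) x ^ 2 ∂(normSurface d) =
      2 * ∑ k ∈ S, sphEigen d (B.deg k) * a k ^ 2 := by
  have h1 : ∀ x : Sph d, ∑ i, ∑ j, restrict (angDeriv i j (angDeriv i j (B.comb a S))) x =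
      -2 * restrict (B.comb (fun k => sphEigen d (B.deg k) * a k) S) x := by
    intro x
    have h2 : ∀ i j, restrict (angDeriv i j (angDeriv i j (B.comb a S))) x =
        ∑ k ∈ S, a k * restrict (angDeriv i j (angDeriv i j (B.poly k))) x := by
      intro i j
      simp only [comb, map_sum, Derivation.map_smul, restrict_sum, restrict_smul]
    simp only [h2]
    rw [Finset.sum_congr rfl fun i _ => Finset.sum_comm, Finset.sum_comm, restrict_comb,
      Finset.mul_sum]
    refine Finset.sum_congr rfl fun k _ => ?_
    simp only [← Finset.mul_sum]
    rw [sum_restrict_angDeriv_angDeriv (B.mem_harmSub k)]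
    ring
  have h3 : ∀ i j, ∫ x, restrict (angDeriv i j (B.comb a S)) x ^ 2 ∂(normSurface d) =
      - ∫ x, restrict (B.comb a S) x *
        restrict (angDeriv i j (angDeriv i j (B.comb a S))) x ∂(normSurface d) := by
    intro i j
    simp only [pow_two]
    exact integral_angDeriv_mul _ _ i j
  simp only [h3, Finset.sum_neg_distrib]
  simp_rw [← integral_finsetSum _ fun i _ => integrable_restrict_mul (B.comb a S) _]
  rw [← integral_finsetSum _ fun i _ => integrable_finsetSum _ fun j _ =>
      integrable_restrict_mul _ _]
  simp only [← Finset.mul_sum, h1]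
  have h4 := B.integral_comb_mul_comb a (fun k => sphEigen d (B.deg k) * a k) S
  have h5 : ∫ x, restrict (B.comb a S) x *
      (-2 * restrict (B.comb (fun k => sphEigen d (B.deg k) * a k) S) x) ∂(normSurface d) =
      -2 * ∑ k ∈ S, a k * (sphEigen d (B.deg k) * a k) := by
    rw [← h4, ← integral_const_mul]
    refine integral_congr_ae (Eventually.of_forall fun x => ?_)
    simp only
    ring
  rw [h5, neg_mul, neg_neg]
  congr 1
  exact Finset.sum_congr rfl fun k _ => by ring

lemma coef_eq_of_isSqrtNegLaplacian {f g : Sph d → ℝ} (h : IsSqrtNegLaplacian f g) (k : B.ι) :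
    B.coef g k = Real.sqrt (sphEigen d (B.deg k)) * B.coef f k :=
  h (B.deg k) _ ⟨B.poly k, (B.mem_harmSub k).1, (B.mem_harmSub k).2, rfl⟩

lemma coef_sq_eq_of_isSqrtNegLaplacian (hd : 2 ≤ d) {f g : Sph d → ℝ}
    (h : IsSqrtNegLaplacian f g) (k : B.ι) :
    B.coef g k ^ 2 = sphEigen d (B.deg k) * B.coef f k ^ 2 := by
  rw [B.coef_eq_of_isSqrtNegLaplacian h, mul_pow, Real.sq_sqrt (sphEigen_nonneg hd _)]

/-- By Parseval, testing against a harmonic of degree `n` only sees the coefficients of degree `n`,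
where the multiplier is a single number. -/
lemma isSqrtNegLaplacian_of_coef (hd : 2 ≤ d) {f g : Sph d → ℝ}
    (hf : MemLp f 2 (normSurface d)) (hg : MemLp g 2 (normSurface d))
    (h : ∀ k, B.coef g k = Real.sqrt (sphEigen d (B.deg k)) * B.coef f k) :
    IsSqrtNegLaplacian f g := by
  rintro n _ ⟨p, hp1, hp2, rfl⟩
  have h1 := B.hasSum_coef_mul (memLp_restrict p) hg
  have h2 := (B.hasSum_coef_mul (memLp_restrict p) hf).mul_left (Real.sqrt (sphEigen d n))
  refine h1.unique (h2.congr_fun ?_)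
  intro k
  by_cases hk : B.deg k = n
  · rw [h k, hk]; ring
  · rw [B.coef_restrict_eq_zero hd ⟨hp1, hp2⟩ hk]; ring

lemma coef_eq_zero_of_deg {f : Sph d → ℝ} (hf : ∫ x, f x ∂(normSurface d) = 0) {k : B.ι}
    (hk : B.deg k = 0) : B.coef f k = 0 := by
  have h := (B.mem_harmSub k).1
  rw [hk, ← totalDegree_zero_iff_isHomogeneous, totalDegree_eq_zero_iff_eq_C] at h
  rw [coef, h]
  simp only [restrict_C, integral_const_mul, hf, mul_zero]

lemma integral_eq_zero_of_coef (hd : 2 ≤ d) {f : Sph d → ℝ} (hf : MemLp f 2 (normSurface d))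
    (h : ∀ k, B.deg k = 0 → B.coef f k = 0) : ∫ x, f x ∂(normSurface d) = 0 := by
  have h1 := B.hasSum_coef_mul (memLp_restrict (C 1)) hf
  have h2 : ∀ k, B.coef (restrict (C 1)) k * B.coef f k = 0 := by
    intro k
    by_cases hk : B.deg k = 0
    · rw [h k hk, mul_zero]
    · rw [B.coef_restrict_eq_zero hd (n := 0) ⟨isHomogeneous_C _ _, by simp [polyLaplacian]⟩ hk,
        zero_mul]
  simp only [h2, restrict_C, one_mul] at h1
  exact h1.unique hasSum_zero

/-- The Poincaré inequality. -/
lemma poincare (B : HarmonicBasis d) (hd : 2 ≤ d) {f g : Sph d → ℝ} (hf : MemLp f 2 (normSurface d))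
    (hg : MemLp g 2 (normSurface d)) (h : IsSqrtNegLaplacian f g)
    (hf0 : ∫ x, f x ∂(normSurface d) = 0) :
    ((d : ℝ) - 1) * ∫ x, f x ^ 2 ∂(normSurface d) ≤ ∫ x, g x ^ 2 ∂(normSurface d) := by
  refine hasSum_le (fun k => ?_) ((B.hasSum_coef_sq hf).mul_left ((d : ℝ) - 1))
    (B.hasSum_coef_sq hg)
  rw [B.coef_sq_eq_of_isSqrtNegLaplacian hd h]
  by_cases hk : B.deg k = 0
  · rw [B.coef_eq_zero_of_deg hf0 hk]; simp
  · have h1 : sphEigen d 1 ≤ sphEigen d (B.deg k) :=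
      (sphEigen_strictMono hd).monotone (Nat.one_le_iff_ne_zero.2 hk)
    have h2 : sphEigen d 1 = (d : ℝ) - 1 := by simp [sphEigen]; ring
    rw [← h2]
    gcongr

/-- The inverse of the square root of the Laplacian. -/
lemma exists_isSqrtNegLaplacian (B : HarmonicBasis d) (hd : 2 ≤ d) {f : Sph d → ℝ} (hf : MemLp f 2 (normSurface d))
    (hf0 : ∫ x, f x ∂(normSurface d) = 0) :
    ∃ g : Sph d → ℝ, MemLp g 2 (normSurface d) ∧ ∫ x, g x ∂(normSurface d) = 0 ∧
      IsSqrtNegLaplacian g f := by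
  -- In degree 0 the divisor vanishes and the quotient is 0 by convention, which is the value wanted
  -- for a function of mean zero. In the other degrees the eigenvalue is at least `d - 1 ≥ 1`, so
  -- `w` stays square-summable.
  set w : B.ι → ℝ := fun k => B.coef f k / Real.sqrt (sphEigen d (B.deg k)) with hw
  have hw2 : Memℓp w 2 := by
    refine memℓp_gen ?_
    have hs := (B.hasSum_coef_sq hf).summable
    refine Summable.of_nonneg_of_le (fun k => by positivity) (fun k => ?_) hs
    simp only [ENNReal.toReal_ofNat, Real.rpow_ofNat, Real.norm_eq_abs, sq_abs, hw, div_pow,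
      Real.sq_sqrt (sphEigen_nonneg hd _)]
    by_cases hk : B.deg k = 0
    · rw [B.coef_eq_zero_of_deg hf0 hk]; simp
    · have h1 : sphEigen d 1 ≤ sphEigen d (B.deg k) :=
        (sphEigen_strictMono hd).monotone (Nat.one_le_iff_ne_zero.2 hk)
      have h2 : sphEigen d 1 = (d : ℝ) - 1 := by simp [sphEigen]; ring
      have h3 : (2 : ℝ) ≤ d := by exact_mod_cast hd
      exact div_le_self (sq_nonneg _) (by linarith)
  set G : Lp ℝ 2 (normSurface d) := B.basis.repr.symm ⟨w, hw2⟩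
  have hG : ∀ k, B.coef G k = w k := by
    intro k
    have h1 := B.inner_basis (Lp.memLp G) k
    rw [Lp.toLp_coeFn, ← B.basis.repr_apply_apply] at h1
    rw [← h1]
    simp [G]
  refine ⟨G, Lp.memLp G, B.integral_eq_zero_of_coef hd (Lp.memLp G) fun k hk => ?_,
    B.isSqrtNegLaplacian_of_coef hd (Lp.memLp G) hf fun k => ?_⟩
  · rw [hG, hw]
    simp [hk, sphEigen_zero]
  · rw [hG]
    by_cases hk : B.deg k = 0
    · rw [B.coef_eq_zero_of_deg hf0 hk]; simp [hk, sphEigen_zero]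
    · have h1 : 0 < sphEigen d (B.deg k) := by
        rw [← sphEigen_zero (d := d)]
        exact sphEigen_strictMono hd (Nat.pos_of_ne_zero hk)
      rw [hw]
      field_simp

lemma ae_eq_of_coef {f g : Sph d → ℝ} (hf : MemLp f 2 (normSurface d))
    (hg : MemLp g 2 (normSurface d)) (h : ∀ k, B.coef f k = B.coef g k) :
    f =ᵐ[normSurface d] g := by
  rw [← MemLp.toLp_eq_toLp_iff hf hg]
  apply B.basis.repr.injective
  ext k
  rw [B.basis.repr_apply_apply, B.basis.repr_apply_apply, inner_basis, inner_basis, h]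

/-- The factors `√λ` and `1 / √λ` cancel coefficientwise in Parseval's identity. With Cauchy-Schwarz
this bounds the norm of `f` by those of `(-Δ₀)^(1/2) f` and `(-Δ₀)^(-1/2) f`. -/
lemma integral_sq_eq_integral_mul (B : HarmonicBasis d) {f g h : Sph d → ℝ}
    (hf : MemLp f 2 (normSurface d)) (hg : MemLp g 2 (normSurface d))
    (hh : MemLp h 2 (normSurface d)) (h1 : IsSqrtNegLaplacian f h)
    (h2 : IsSqrtNegLaplacian g f) :
    ∫ x, f x ^ 2 ∂(normSurface d) = ∫ x, h x * g x ∂(normSurface d) := by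
  refine (B.hasSum_coef_sq hf).unique ((B.hasSum_coef_mul hh hg).congr_fun fun k => ?_)
  rw [B.coef_eq_of_isSqrtNegLaplacian h1, B.coef_eq_of_isSqrtNegLaplacian h2]
  ring

lemma integral_comb_sub_sq {f : Sph d → ℝ} (hf : MemLp f 2 (normSurface d)) (S : Finset B.ι) :
    ∫ x, (restrict (B.comb (B.coef f) S) x - f x) ^ 2 ∂(normSurface d) =
      ∫ x, f x ^ 2 ∂(normSurface d) - ∑ k ∈ S, B.coef f k ^ 2 := by
  set p := B.comb (B.coef f) S
  have h1 : ∫ x, restrict p x * restrict p x ∂(normSurface d) = ∑ k ∈ S, B.coef f k ^ 2 := by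
    rw [B.integral_comb_mul_comb]; simp only [pow_two]
  have h2 : ∫ x, restrict p x * f x ∂(normSurface d) = ∑ k ∈ S, B.coef f k ^ 2 := by
    rw [B.integral_comb_mul _ _ hf]; simp only [pow_two]
  have e : ∀ x, (restrict p x - f x) ^ 2 =
      restrict p x * restrict p x - 2 * (restrict p x * f x) + f x ^ 2 := fun x => by ring
  have i1 := integrable_restrict_mul p p
  have i2 : Integrable (fun x => 2 * (restrict p x * f x)) (normSurface d) :=
    ((memLp_restrict p).integrable_mul hf).const_mul 2
  have i12 : Integrable (fun x => restrict p x * restrict p x - 2 * (restrict p x * f x))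
    (normSurface d) := i1.sub i2
  simp only [e]
  rw [integral_add i12 hf.integrable_sq, integral_sub i1 i2, integral_const_mul, h1, h2]
  ring

end HarmonicBasis

/-! ### Convergence of weighted square integrals of partial sums. -/

section Approximation

open MvPolynomial Filter Topology

variable {d : ℕ}

lemma memLp_continuous_mul {w f : Sph d → ℝ} (hw : Continuous w)
    (hf : MemLp f 2 (normSurface d)) : MemLp (fun x => w x * f x) 2 (normSurface d) := by
  obtain ⟨C, hC⟩ := isCompact_univ.exists_bound_of_continuousOn hw.continuousOn
  refine hf.of_le_mul (c := C) (hw.aestronglyMeasurable.mul hf.1) (Eventually.of_forall fun x => ?_)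
  rw [norm_mul]
  exact mul_le_mul_of_nonneg_right (hC x trivial) (norm_nonneg _)

/-- With `p` the partial sum, `w p² - w f² = 2 (p - f) w f + w (p - f)²`. Both terms are controlled
by the `L²` distance of `p` and `f`, which tends to 0 by Parseval. -/
lemma HarmonicBasis.tendsto_integral_mul_comb_sq (B : HarmonicBasis d) {w f : Sph d → ℝ}
    (hw : Continuous w) (hf : MemLp f 2 (normSurface d)) :
    Tendsto (fun S => ∫ x, w x * restrict (B.comb (B.coef f) S) x ^ 2 ∂(normSurface d)) atTop
      (𝓝 (∫ x, w x * f x ^ 2 ∂(normSurface d))) := by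
  set Q : Finset B.ι → ℝ := fun S =>
    ∫ x, (restrict (B.comb (B.coef f) S) x - f x) ^ 2 ∂(normSurface d) with hQ
  have hQ0 : Tendsto Q atTop (𝓝 0) := by
    have h : Tendsto (fun S => ∫ x, f x ^ 2 ∂(normSurface d) - ∑ k ∈ S, B.coef f k ^ 2) atTop
        (𝓝 (∫ x, f x ^ 2 ∂(normSurface d) - ∫ x, f x ^ 2 ∂(normSurface d))) :=
      (B.hasSum_coef_sq hf).const_sub _
    rw [sub_self] at h
    exact h.congr fun S => (B.integral_comb_sub_sq hf S).symm
  obtain ⟨M, hM⟩ := isCompact_univ.exists_bound_of_continuousOn hw.continuousOn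
  have hwf := memLp_continuous_mul hw hf
  have hM0 : ∀ x, |w x| ≤ M := fun x => hM x trivial
  have hbound : ∀ S, ‖∫ x, w x * restrict (B.comb (B.coef f) S) x ^ 2 ∂(normSurface d) -
      ∫ x, w x * f x ^ 2 ∂(normSurface d)‖ ≤
      2 * (Real.sqrt (Q S) * Real.sqrt (∫ x, (w x * f x) ^ 2 ∂(normSurface d))) + M * Q S := by
    intro S
    set p := B.comb (B.coef f) S
    have hq : MemLp (fun x => restrict p x - f x) 2 (normSurface d) := (memLp_restrict p).sub hf
    have e : ∀ x, w x * restrict p x ^ 2 = w x * f x ^ 2 +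
        (2 * ((restrict p x - f x) * (w x * f x)) + w x * (restrict p x - f x) ^ 2) :=
      fun x => by ring
    have i0 : Integrable (fun x => w x * f x ^ 2) (normSurface d) := by
      refine (hwf.integrable_mul hf).congr (Eventually.of_forall fun x => ?_)
      simp only [Pi.mul_apply]; ring
    have i1 : Integrable (fun x => 2 * ((restrict p x - f x) * (w x * f x))) (normSurface d) :=
      (hq.integrable_mul hwf).const_mul 2
    have i2 : Integrable (fun x => w x * (restrict p x - f x) ^ 2) (normSurface d) := by
      refine ((memLp_continuous_mul hw hq).integrable_mul hq).congr
        (Eventually.of_forall fun x => ?_)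
      simp only [Pi.mul_apply]; ring
    have i12 : Integrable (fun x => 2 * ((restrict p x - f x) * (w x * f x)) +
      w x * (restrict p x - f x) ^ 2) (normSurface d) := i1.add i2
    simp only [e]
    rw [integral_add i0 i12, integral_add i1 i2, integral_const_mul, add_sub_cancel_left]
    refine (norm_add_le _ _).trans (add_le_add ?_ ?_)
    · rw [norm_mul, Real.norm_eq_abs, Real.norm_eq_abs, abs_two]
      refine mul_le_mul_of_nonneg_left ?_ zero_le_two
      rw [← Real.sqrt_mul (integral_nonneg fun x => sq_nonneg _)]
      exact Real.abs_le_sqrt (integral_mul_sq_le hq hwf)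
    · rw [← integral_const_mul]
      refine norm_integral_le_of_norm_le (hq.integrable_sq.const_mul M)
        (Eventually.of_forall fun x => ?_)
      rw [norm_mul, Real.norm_eq_abs, Real.norm_eq_abs, abs_of_nonneg (sq_nonneg (restrict p x - f x))]
      exact mul_le_mul_of_nonneg_right (hM0 x) (sq_nonneg _)
  rw [tendsto_iff_norm_sub_tendsto_zero]
  refine squeeze_zero (fun _ => norm_nonneg _) hbound ?_
  have hsq : Tendsto (fun S => Real.sqrt (Q S)) atTop (𝓝 0) := by
    simpa [Function.comp_def] using (Real.continuous_sqrt.tendsto 0).comp hQ0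
  simpa using ((hsq.mul_const _).const_mul 2).add (hQ0.const_mul M)

end Approximation

/-! ### The height function and the uncertainty inequality -/

section Height

open MvPolynomial Filter Topology

variable {d : ℕ}

/-- The height function `⟨x, e⟩`. -/
def height (e x : Sph d) : ℝ :=
  inner ℝ (x : EuclideanSpace ℝ (Fin d)) (e : EuclideanSpace ℝ (Fin d))

/-- The height function as a polynomial. -/
def heightPoly (e : Sph d) : MvPolynomial (Fin d) ℝ :=
  ∑ i, C ((e : EuclideanSpace ℝ (Fin d)) i) * X i

lemma restrict_heightPoly (e x : Sph d) : restrict (heightPoly e) x = height e x := by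
  simp [restrict, heightPoly, height, PiLp.inner_apply]

lemma continuous_height (e : Sph d) : Continuous (height e) := by
  unfold height; fun_prop

lemma height_le_one (e x : Sph d) : height e x ≤ 1 := by
  have h := real_inner_le_norm (x : EuclideanSpace ℝ (Fin d)) (e : EuclideanSpace ℝ (Fin d))
  simpa [height] using h

lemma neg_one_le_height (e x : Sph d) : -1 ≤ height e x := by
  have h := neg_le_of_abs_le
    (abs_real_inner_le_norm (x : EuclideanSpace ℝ (Fin d)) (e : EuclideanSpace ℝ (Fin d)))
  simpa [height] using h

lemma norm_sub_sq_eq (e x : Sph d) :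
    ‖(x : EuclideanSpace ℝ (Fin d)) - e‖ ^ 2 = 2 * (1 - height e x) := by
  rw [norm_sub_sq_real]
  simp [height]
  ring

lemma pderiv_heightPoly (e : Sph d) (i : Fin d) :
    pderiv i (heightPoly e) = C ((e : EuclideanSpace ℝ (Fin d)) i) := by
  simp only [heightPoly, map_sum, pderiv_C_mul, pderiv_X_eq]
  simp

lemma angDeriv_heightPoly (e : Sph d) (i j : Fin d) (x : Sph d) :
    restrict (angDeriv i j (heightPoly e)) x =
      (x : EuclideanSpace ℝ (Fin d)) i * (e : EuclideanSpace ℝ (Fin d)) j -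
        (x : EuclideanSpace ℝ (Fin d)) j * (e : EuclideanSpace ℝ (Fin d)) i := by
  simp [angDeriv_apply, pderiv_heightPoly, restrict]

/-- Lagrange's identity. -/
lemma sum_sum_sub_sq (a b : Fin d → ℝ) :
    ∑ i, ∑ j, (a i * b j - a j * b i) ^ 2 =
      2 * ((∑ i, a i ^ 2) * (∑ i, b i ^ 2) - (∑ i, a i * b i) ^ 2) := by
  have e : ∀ i j, (a i * b j - a j * b i) ^ 2 =
      a i ^ 2 * b j ^ 2 + b i ^ 2 * a j ^ 2 - 2 * ((a i * b i) * (a j * b j)) :=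
    fun i j => by ring
  simp only [e, Finset.sum_add_distrib, Finset.sum_sub_distrib, ← Finset.mul_sum, ← Finset.sum_mul]
  ring

/-- Lagrange's identity for two unit vectors: `|∇₀ t|² = 1 - t²`, the factor 2 coming from ordered
pairs. -/
lemma sum_angDeriv_heightPoly_sq (e x : Sph d) :
    ∑ i, ∑ j, restrict (angDeriv i j (heightPoly e)) x ^ 2 = 2 * (1 - height e x ^ 2) := by
  simp only [angDeriv_heightPoly]
  rw [sum_sum_sub_sq, sum_sq_sph, sum_sq_sph]
  simp [height, PiLp.inner_apply, mul_comm]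

lemma heightPoly_mem_harmSub (e : Sph d) : heightPoly e ∈ harmSub d 1 := by
  refine ⟨IsHomogeneous.sum _ _ _ fun i _ => ?_, ?_⟩
  · simpa using (isHomogeneous_C (Fin d) _).mul (isHomogeneous_X ℝ i)
  · simp [polyLaplacian, pderiv_heightPoly]

lemma sum_angDeriv_angDeriv_heightPoly (e x : Sph d) :
    ∑ i, ∑ j, restrict (angDeriv i j (angDeriv i j (heightPoly e))) x =
      -2 * ((d : ℝ) - 1) * height e x := by
  rw [sum_restrict_angDeriv_angDeriv (heightPoly_mem_harmSub e), restrict_heightPoly, sphEigen]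
  push_cast
  ring

/-- The Dirichlet energy (twice the integral of the squared tangential gradient). -/
def energy (p : MvPolynomial (Fin d) ℝ) : ℝ :=
  ∑ i, ∑ j, ∫ x, restrict (angDeriv i j p) x ^ 2 ∂(normSurface d)

lemma energy_nonneg (p : MvPolynomial (Fin d) ℝ) : 0 ≤ energy p :=
  Finset.sum_nonneg fun _ _ => Finset.sum_nonneg fun _ _ => integral_nonneg fun _ => sq_nonneg _

/-- Cauchy-Schwarz for matrix-valued functions in `L²`. -/
lemma sum_integral_mul_sq_le {f g : Fin d → Fin d → Sph d → ℝ}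
    (hf : ∀ i j, Continuous (f i j)) (hg : ∀ i j, Continuous (g i j)) :
    (∑ i, ∑ j, ∫ x, f i j x * g i j x ∂(normSurface d)) ^ 2 ≤
      (∑ i, ∑ j, ∫ x, f i j x ^ 2 ∂(normSurface d)) *
        ∑ i, ∑ j, ∫ x, g i j x ^ 2 ∂(normSurface d) := by
  have h0 : ∀ (f : Fin d → Fin d → Sph d → ℝ) i j, 0 ≤ ∫ x, f i j x ^ 2 ∂(normSurface d) :=
    fun f i j => integral_nonneg fun x => sq_nonneg _
  refine Finset.sum_sq_le_sum_mul_sum_of_sq_le_mul _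
    (fun i _ => Finset.sum_nonneg fun j _ => h0 f i j)
    (fun i _ => Finset.sum_nonneg fun j _ => h0 g i j) fun i _ => ?_
  refine Finset.sum_sq_le_sum_mul_sum_of_sq_le_mul _ (fun j _ => h0 f i j) (fun j _ => h0 g i j)
    fun j _ => ?_
  exact integral_mul_sq_le (memLp_of_continuous (hf i j)) (memLp_of_continuous (hg i j))

lemma sum_integral_eq {f : Fin d → Fin d → Sph d → ℝ} (hf : ∀ i j, Continuous (f i j)) :
    ∑ i, ∑ j, ∫ x, f i j x ∂(normSurface d) = ∫ x, ∑ i, ∑ j, f i j x ∂(normSurface d) := by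
  rw [integral_finsetSum _ fun i _ => integrable_finsetSum _ fun j _ =>
    integrable_of_continuous (hf i j)]
  refine Finset.sum_congr rfl fun i _ => ?_
  rw [integral_finsetSum _ fun j _ => integrable_of_continuous (hf i j)]

/-- Since `t` is an eigenfunction with eigenvalue `d - 1`, integrating `D_ij² t` against `p²` by
parts turns `(d - 1) ∫ t p²` into the sum of `∫ (D_ij p) (p D_ij t)`; then apply Cauchy-Schwarz and
`∑ (D_ij t)² = 2 (1 - t²)`. -/
lemma integral_height_mul_sq_le_energy (e : Sph d) (p : MvPolynomial (Fin d) ℝ) :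
    (((d : ℝ) - 1) * ∫ x, height e x * restrict p x ^ 2 ∂(normSurface d)) ^ 2 ≤
      2 * energy p * ∫ x, (1 - height e x ^ 2) * restrict p x ^ 2 ∂(normSurface d) := by
  have h1 : ∀ i j, ∫ x, restrict (p * p) x *
      restrict (angDeriv i j (angDeriv i j (heightPoly e))) x ∂(normSurface d) =
      -2 * ∫ x, restrict (angDeriv i j p) x *
        (restrict p x * restrict (angDeriv i j (heightPoly e)) x) ∂(normSurface d) := by
    intro i j
    have h := integral_angDeriv_mul (p * p) (angDeriv i j (heightPoly e)) i j
    rw [eq_neg_iff_add_eq_zero, add_comm, ← eq_neg_iff_add_eq_zero] at h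
    rw [h, neg_mul, ← integral_const_mul]
    congr 1
    refine integral_congr_ae (Eventually.of_forall fun x => ?_)
    simp only [Derivation.leibniz, smul_eq_mul, restrict_add, restrict_mul]
    ring
  have h2 := Finset.sum_congr rfl fun i (_ : i ∈ Finset.univ) =>
    Finset.sum_congr rfl fun j (_ : j ∈ Finset.univ) => h1 i j
  have c1 := continuous_restrict p
  have c2 := fun i j => continuous_restrict (angDeriv i j (heightPoly e))
  rw [sum_integral_eq (f := fun i j x => restrict (p * p) x *
      restrict (angDeriv i j (angDeriv i j (heightPoly e))) x)
    fun i j => (continuous_restrict (p * p)).mul (continuous_restrict _)] at h2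
  simp only [← Finset.mul_sum, sum_angDeriv_angDeriv_heightPoly, restrict_mul] at h2
  have h3 : ((d : ℝ) - 1) * ∫ x, height e x * restrict p x ^ 2 ∂(normSurface d) =
      ∑ i, ∑ j, ∫ x, restrict (angDeriv i j p) x *
        (restrict p x * restrict (angDeriv i j (heightPoly e)) x) ∂(normSurface d) := by
    have h4 : ∫ x, restrict p x * restrict p x * (-2 * ((d : ℝ) - 1) * height e x)
        ∂(normSurface d) =
        -2 * (((d : ℝ) - 1) * ∫ x, height e x * restrict p x ^ 2 ∂(normSurface d)) := by
      rw [← integral_const_mul, ← integral_const_mul]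
      refine integral_congr_ae (Eventually.of_forall fun x => ?_)
      simp only
      ring
    rw [h4] at h2
    linarith
  rw [h3]
  refine (sum_integral_mul_sq_le
    (g := fun i j x => restrict p x * restrict (angDeriv i j (heightPoly e)) x)
    (fun i j => continuous_restrict _) fun i j => c1.mul (c2 i j)).trans (le_of_eq ?_)
  rw [sum_integral_eq (f := fun i j x => (restrict p x *
      restrict (angDeriv i j (heightPoly e)) x) ^ 2)
    fun i j => (c1.mul (c2 i j)).pow 2]
  simp only [mul_pow, ← Finset.mul_sum, sum_angDeriv_heightPoly_sq]
  have h5 : ∫ x, restrict p x ^ 2 * (2 * (1 - height e x ^ 2)) ∂(normSurface d) =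
      2 * ∫ x, (1 - height e x ^ 2) * restrict p x ^ 2 ∂(normSurface d) := by
    rw [← integral_const_mul]
    congr 1
    funext x
    ring
  rw [h5, energy]
  ring

lemma HarmonicBasis.energy_comb (B : HarmonicBasis d) (a : B.ι → ℝ) (S : Finset B.ι) :
    energy (B.comb a S) = 2 * ∑ k ∈ S, sphEigen d (B.deg k) * a k ^ 2 :=
  B.sum_integral_angDeriv_comb_sq a S

/-- The uncertainty inequality for a real function on the sphere. -/
lemma integral_height_mul_sq_le (hd : 2 ≤ d) (e : Sph d) {f g : Sph d → ℝ}
    (hf : MemLp f 2 (normSurface d)) (hg : MemLp g 2 (normSurface d))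
    (h : IsSqrtNegLaplacian f g) :
    (((d : ℝ) - 1) * ∫ x, height e x * f x ^ 2 ∂(normSurface d)) ^ 2 ≤
      4 * (∫ x, g x ^ 2 ∂(normSurface d)) *
        ∫ x, (1 - height e x ^ 2) * f x ^ 2 ∂(normSurface d) := by
  obtain ⟨B⟩ := nonempty_harmonicBasis hd
  have l1 := ((B.tendsto_integral_mul_comb_sq (continuous_height e) hf).const_mul
    ((d : ℝ) - 1)).pow 2
  have l2 := (B.tendsto_integral_mul_comb_sq (w := fun x => 1 - height e x ^ 2)
    (continuous_const.sub ((continuous_height e).pow 2)) hf).const_mul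
    (4 * ∫ x, g x ^ 2 ∂(normSurface d))
  refine le_of_tendsto_of_tendsto' l1 l2 fun S => ?_
  refine (integral_height_mul_sq_le_energy e _).trans ?_
  -- Bessel's inequality for `g`, whose squared coefficients are the eigenvalues times those of `f`.
  have hE : energy (B.comb (B.coef f) S) ≤ 2 * ∫ x, g x ^ 2 ∂(normSurface d) := by
    rw [B.energy_comb]
    refine mul_le_mul_of_nonneg_left ?_ zero_le_two
    simp only [← B.coef_sq_eq_of_isSqrtNegLaplacian hd h]
    exact sum_le_hasSum S (fun _ _ => sq_nonneg _) (B.hasSum_coef_sq hg)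
  refine mul_le_mul_of_nonneg_right (by linarith) (integral_nonneg fun x => mul_nonneg ?_ (sq_nonneg _))
  nlinarith [height_le_one e x, neg_one_le_height e x]

end Height

/-! ### Hardy's inequality -/

section Hardy

open MvPolynomial Filter Topology

variable {d : ℕ}

/-- The weight `1 / (a - ⟨x, e⟩)`. -/
def hardyWeight (a : ℝ) (e x : Sph d) : ℝ := (a - height e x)⁻¹

lemma sub_height_pos {a : ℝ} (ha : 1 < a) (e x : Sph d) : 0 < a - height e x := by
  linarith [height_le_one e x]

lemma hardyWeight_pos {a : ℝ} (ha : 1 < a) (e x : Sph d) : 0 < hardyWeight a e x :=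
  inv_pos.2 (sub_height_pos ha e x)

lemma hardyWeight_mul {a : ℝ} (ha : 1 < a) (e x : Sph d) :
    hardyWeight a e x * (a - height e x) = 1 :=
  inv_mul_cancel₀ (sub_height_pos ha e x).ne'

lemma continuous_hardyWeight {a : ℝ} (ha : 1 < a) (e : Sph d) : Continuous (hardyWeight a e) :=
  (continuous_const.sub (continuous_height e)).inv₀ fun x => (sub_height_pos ha e x).ne'

/-- Integration by parts for the weight `w = 1 / (a - t)`, whose angular derivatives are `w² D_ij
t`. -/
lemma integral_hardyWeight_sq_mul {a : ℝ} (ha : 1 < a) (e : Sph d) (q : MvPolynomial (Fin d) ℝ)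
    (i j : Fin d) :
    ∫ x, hardyWeight a e x ^ 2 * restrict (angDeriv i j (heightPoly e)) x * restrict q x
        ∂(normSurface d) =
      - ∫ x, hardyWeight a e x * restrict (angDeriv i j q) x ∂(normSurface d) := by
  have hF : ∀ x : Sph d, ContDiffAt ℝ 1
      (fun y : EuclideanSpace ℝ (Fin d) => (a - polyFun (heightPoly e) y)⁻¹) x := by
    intro x
    have h1 : a - polyFun (heightPoly e) x ≠ 0 := by
      have := (sub_height_pos ha e x).ne'
      rwa [← restrict_heightPoly] at this
    exact (contDiffAt_const.sub (contDiff_polyFun (heightPoly e)).contDiffAt).inv h1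
  have h := integral_fderiv_infRot_mul hF q i j
  have e1 : ∀ x : Sph d, (a - polyFun (heightPoly e) x)⁻¹ = hardyWeight a e x := fun x => by
    rw [hardyWeight, ← restrict_heightPoly]; rfl
  simp only [e1] at h
  rw [← h]
  refine integral_congr_ae (Eventually.of_forall fun x => ?_)
  have h1 : a - polyFun (heightPoly e) x ≠ 0 := by
    have := (sub_height_pos ha e x).ne'
    rwa [← restrict_heightPoly] at this
  have h2 : HasFDerivAt (fun y : EuclideanSpace ℝ (Fin d) => (a - polyFun (heightPoly e) y)⁻¹)
      _ (x : EuclideanSpace ℝ (Fin d)) :=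
    (hasDerivAt_inv h1).comp_hasFDerivAt (x : EuclideanSpace ℝ (Fin d)) (((contDiff_polyFun (heightPoly e)).differentiable
      (by norm_num) x).hasFDerivAt.const_sub a)
  simp only [h2.fderiv, smul_apply, neg_apply, fderiv_polyFun_infRot, smul_eq_mul, hardyWeight,
    ← restrict_heightPoly]
  rw [show polyFun (heightPoly e) x = restrict (heightPoly e) x from rfl, ← inv_pow]
  ring

lemma sum_integral_hardyWeight_sq_le {a : ℝ} (ha : 1 < a) (e : Sph d)
    (p : MvPolynomial (Fin d) ℝ) :
    ∑ i, ∑ j, ∫ x, (hardyWeight a e x * restrict p x *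
      restrict (angDeriv i j (heightPoly e)) x) ^ 2 ∂(normSurface d) ≤
      4 * ∫ x, hardyWeight a e x * restrict p x ^ 2 ∂(normSurface d) := by
  have cw := continuous_hardyWeight ha e
  have cp := continuous_restrict p
  have cD := fun i j => continuous_restrict (angDeriv i j (heightPoly e))
  rw [sum_integral_eq (f := fun i j x => (hardyWeight a e x * restrict p x *
      restrict (angDeriv i j (heightPoly e)) x) ^ 2)
    fun i j => ((cw.mul cp).mul (cD i j)).pow 2, ← integral_const_mul]
  refine integral_mono (integrable_of_continuous (by fun_prop))
    (integrable_of_continuous (by fun_prop)) fun x => ?_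
  simp only [mul_pow, ← Finset.mul_sum, sum_angDeriv_heightPoly_sq]
  have w0 := hardyWeight_pos ha e x
  have w1 := hardyWeight_mul ha e x
  have t1 := height_le_one e x
  have t2 := neg_one_le_height e x
  have : hardyWeight a e x * (1 - height e x ^ 2) ≤ 2 := by
    have : 1 - height e x ^ 2 ≤ (a - height e x) * 2 := by nlinarith
    calc _ ≤ hardyWeight a e x * ((a - height e x) * 2) := mul_le_mul_of_nonneg_left this w0.le
      _ = 2 := by rw [← mul_assoc, w1, one_mul]
  have h4 := mul_le_mul_of_nonneg_left this (mul_nonneg w0.le (sq_nonneg (restrict p x)))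
  nlinarith

/-- Take `q = p² D_ij t` in `integral_hardyWeight_sq_mul` and sum. The term with `D_ij² t` produces
`(d - 1) ∫ w t p²`, and the difference on the left is minus the sum of `∫ (D_ij p) (w p D_ij t)`.
Cauchy-Schwarz and `w (1 - t²) ≤ 2` finish. -/
lemma hardy_aux {a : ℝ} (ha : 1 < a) (e : Sph d) (p : MvPolynomial (Fin d) ℝ) :
    (∫ x, hardyWeight a e x ^ 2 * (1 - height e x ^ 2) * restrict p x ^ 2 ∂(normSurface d) -
      ((d : ℝ) - 1) * ∫ x, hardyWeight a e x * height e x * restrict p x ^ 2 ∂(normSurface d)) ^ 2 ≤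
      4 * energy p * ∫ x, hardyWeight a e x * restrict p x ^ 2 ∂(normSurface d) := by
  have cw := continuous_hardyWeight ha e
  have ct := continuous_height e
  have cp := continuous_restrict p
  have cD := fun i j => continuous_restrict (angDeriv i j (heightPoly e))
  have cDp := fun i j => continuous_restrict (angDeriv i j p)
  have cDD := fun i j => continuous_restrict (angDeriv i j (angDeriv i j (heightPoly e)))
  have h1 : ∀ i j, ∫ x, hardyWeight a e x ^ 2 * restrict (angDeriv i j (heightPoly e)) x ^ 2 *
      restrict p x ^ 2 ∂(normSurface d) =
      - ∫ x, (2 * (restrict (angDeriv i j p) x *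
        (hardyWeight a e x * restrict p x * restrict (angDeriv i j (heightPoly e)) x)) +
        hardyWeight a e x * restrict p x ^ 2 *
          restrict (angDeriv i j (angDeriv i j (heightPoly e))) x) ∂(normSurface d) := by
    intro i j
    have h := integral_hardyWeight_sq_mul ha e (p * p * angDeriv i j (heightPoly e)) i j
    convert h using 2
    · funext x
      simp only [restrict_mul]
      ring
    · congr 1
      funext x
      simp only [Derivation.leibniz, smul_eq_mul, restrict_add, restrict_mul]
      ring
  have h2 := Finset.sum_congr rfl fun i (_ : i ∈ Finset.univ) =>
    Finset.sum_congr rfl fun j (_ : j ∈ Finset.univ) => h1 i j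
  have c1 : ∀ i j, Continuous fun x => restrict (angDeriv i j p) x *
      (hardyWeight a e x * restrict p x * restrict (angDeriv i j (heightPoly e)) x) :=
    fun i j => (cDp i j).mul ((cw.mul cp).mul (cD i j))
  have c2 : ∀ i j, Continuous fun x => hardyWeight a e x * restrict p x ^ 2 *
          restrict (angDeriv i j (angDeriv i j (heightPoly e))) x :=
    fun i j => (cw.mul (cp.pow 2)).mul (cDD i j)
  simp only [fun i j => integral_add (integrable_of_continuous ((c1 i j).const_mul 2))
    (integrable_of_continuous (c2 i j)), integral_const_mul] at h2
  rw [sum_integral_eq (f := fun i j x => hardyWeight a e x ^ 2 *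
      restrict (angDeriv i j (heightPoly e)) x ^ 2 * restrict p x ^ 2)
    fun i j => ((cw.pow 2).mul ((cD i j).pow 2)).mul (cp.pow 2)] at h2
  simp only [Finset.sum_neg_distrib, Finset.sum_add_distrib, ← Finset.mul_sum] at h2
  rw [sum_integral_eq c2] at h2
  simp only [← Finset.mul_sum, ← Finset.sum_mul, sum_angDeriv_heightPoly_sq,
    sum_angDeriv_angDeriv_heightPoly] at h2
  have e1 : ∫ x, hardyWeight a e x ^ 2 * (2 * (1 - height e x ^ 2)) * restrict p x ^ 2
      ∂(normSurface d) = 2 * ∫ x, hardyWeight a e x ^ 2 * (1 - height e x ^ 2) * restrict p x ^ 2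
      ∂(normSurface d) := by
    rw [← integral_const_mul]
    congr 1
    funext x
    ring
  have e2 : ∫ x, hardyWeight a e x * restrict p x ^ 2 * (-2 * ((d : ℝ) - 1) * height e x)
      ∂(normSurface d) = -2 * (((d : ℝ) - 1) *
        ∫ x, hardyWeight a e x * height e x * restrict p x ^ 2 ∂(normSurface d)) := by
    rw [← integral_const_mul, ← integral_const_mul]
    congr 1
    funext x
    ring
  rw [e1, e2] at h2
  have h3 := sum_integral_mul_sq_le (g := fun i j x => hardyWeight a e x * restrict p x *
      restrict (angDeriv i j (heightPoly e)) x) cDp fun i j => (cw.mul cp).mul (cD i j)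
  have e3 := sum_integral_hardyWeight_sq_le ha e p
  calc _ = (∑ i, ∑ j, ∫ x, restrict (angDeriv i j p) x * (hardyWeight a e x * restrict p x *
        restrict (angDeriv i j (heightPoly e)) x) ∂(normSurface d)) ^ 2 := by
        rw [← neg_sq (∑ i, ∑ j, _)]
        congr 1
        linarith
    _ ≤ _ := h3
    _ ≤ energy p * (4 * ∫ x, hardyWeight a e x * restrict p x ^ 2 ∂(normSurface d)) :=
        mul_le_mul_of_nonneg_left e3 (energy_nonneg p)
    _ = _ := by ring

/-- Hardy's inequality in dimension at least four. -/
lemma hardy_of_four_le (hd : 4 ≤ d) {a : ℝ} (ha : 1 < a) (e : Sph d) (p : MvPolynomial (Fin d) ℝ)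
    (hp : 2 * ((d : ℝ) - 1) * ∫ x, restrict p x ^ 2 ∂(normSurface d) ≤ energy p) :
    ∫ x, hardyWeight a e x * restrict p x ^ 2 ∂(normSurface d) ≤ 5 * energy p := by
  have hd' : (4 : ℝ) ≤ d := by exact_mod_cast hd
  have h := hardy_aux ha e p
  have cw := continuous_hardyWeight ha e
  have ct := continuous_height e
  have cp := continuous_restrict p
  set X := ∫ x, hardyWeight a e x * restrict p x ^ 2 ∂(normSurface d) with hX
  set P := ∫ x, restrict p x ^ 2 ∂(normSurface d) with hP
  set L := ∫ x, hardyWeight a e x ^ 2 * (1 - height e x ^ 2) * restrict p x ^ 2 ∂(normSurface d) -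
      ((d : ℝ) - 1) * ∫ x, hardyWeight a e x * height e x * restrict p x ^ 2 ∂(normSurface d)
    with hL
  have hX0 : 0 ≤ X := integral_nonneg fun x =>
    mul_nonneg (hardyWeight_pos ha e x).le (sq_nonneg _)
  have hP0 : 0 ≤ P := integral_nonneg fun x => sq_nonneg _
  have hE := energy_nonneg p
  -- Pointwise, `w (1 - t) ≤ 1` gives `w² (1 - t²) ≤ w (1 + t)`; then `w t = a w - 1` and `a ≥ 1`.
  -- The coefficient `d - 3` is what excludes dimension three.
  have hle : L ≤ ((d : ℝ) - 2) * P - ((d : ℝ) - 3) * X := by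
    rw [hL, hP, hX, ← integral_const_mul, ← integral_const_mul, ← integral_const_mul,
      ← integral_sub (integrable_of_continuous (by fun_prop))
        (integrable_of_continuous (by fun_prop)),
      ← integral_sub (integrable_of_continuous (by fun_prop))
        (integrable_of_continuous (by fun_prop))]
    refine integral_mono (integrable_of_continuous (by fun_prop))
      (integrable_of_continuous (by fun_prop)) fun x => ?_
    have w0 := hardyWeight_pos ha e x
    have w1 := hardyWeight_mul ha e x
    have t1 := height_le_one e x
    have t2 := neg_one_le_height e x
    simp only
    set w := hardyWeight a e x
    set t := height e x
    have h1 : w * (1 - t) ≤ 1 := by nlinarith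
    have h2 : w ^ 2 * (1 - t ^ 2) ≤ w * (1 + t) := by
      have := mul_le_mul_of_nonneg_right h1 (mul_nonneg w0.le (by linarith : 0 ≤ 1 + t))
      nlinarith
    have h3 : w ^ 2 * (1 - t ^ 2) - ((d : ℝ) - 1) * (w * t) ≤
        ((d : ℝ) - 2) - ((d : ℝ) - 3) * w := by
      have h4 : w * t = a * w - 1 := by linarith
      have h5 : 0 ≤ ((d : ℝ) - 2) * ((a - 1) * w) :=
        mul_nonneg (by linarith) (mul_nonneg (by linarith) w0.le)
      nlinarith
    have := mul_le_mul_of_nonneg_right h3 (sq_nonneg (restrict p x))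
    linarith
  -- From `L² ≤ 4 E X` with `E = energy p`: `4 E X ≤ (X / 2 + 2 E)²` by the arithmetic-geometric
  -- mean inequality. The split leaves half of `X` to be absorbed on the other side.
  have habs : -L ≤ X / 2 + 2 * energy p := by
    refine neg_le.1 (abs_le.1 (abs_le_of_sq_le_sq (h.trans ?_) (by linarith))).1
    nlinarith [sq_nonneg (X / 2 - 2 * energy p)]
  -- The Poincaré hypothesis enters here. Altogether `X ≤ E / 2 + X / 2 + 2 E`, which is the
  -- constant 5.
  have h6 : ((d : ℝ) - 2) * P ≤ energy p / 2 := by nlinarith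
  have h7 : X ≤ ((d : ℝ) - 3) * X := by nlinarith
  linarith

/-- A polynomial is Lipschitz on the unit ball, and `|x - e|² = 2 (1 - t)`. This supplies the bound
`w p² ≤ K`, uniform in `a`, used on the circle. -/
lemma exists_sq_le_of_restrict_eq_zero (e : Sph d) (p : MvPolynomial (Fin d) ℝ)
    (hp : restrict p e = 0) : ∃ K, 0 ≤ K ∧ ∀ x, restrict p x ^ 2 ≤ K * (1 - height e x) := by
  have hc : Continuous (fderiv ℝ (polyFun p)) := (contDiff_polyFun p).continuous_fderiv (by norm_num)
  obtain ⟨M, hM⟩ := (isCompact_closedBall (0 : EuclideanSpace ℝ (Fin d)) 1).exists_bound_of_continuousOn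
    hc.continuousOn
  refine ⟨2 * M ^ 2, by positivity, fun x => ?_⟩
  have h := (convex_closedBall (0 : EuclideanSpace ℝ (Fin d)) 1).norm_image_sub_le_of_norm_fderiv_le
    (f := polyFun p) (𝕜 := ℝ) (C := M) (x := e) (y := x)
    (fun y _ => (contDiff_polyFun p).differentiable (by norm_num) y) hM (by simp) (by simp)
  have h0 : polyFun p e = 0 := hp
  rw [h0, sub_zero, Real.norm_eq_abs] at h
  have h1 : restrict p x ^ 2 ≤ (M * ‖(x : EuclideanSpace ℝ (Fin d)) - e‖) ^ 2 := by
    rw [← sq_abs]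
    exact pow_le_pow_left₀ (abs_nonneg _) h 2
  rw [mul_pow, norm_sub_sq_eq] at h1
  linarith

/-- Hardy's inequality on the circle, with an error term. -/
lemma hardy_of_eq_two (hd : d = 2) {a : ℝ} (ha : 1 < a) (e : Sph d) (p : MvPolynomial (Fin d) ℝ)
    {K : ℝ} (hp : ∀ x, restrict p x ^ 2 ≤ K * (1 - height e x)) (hK : 0 ≤ K) :
    ∫ x, hardyWeight a e x * restrict p x ^ 2 ∂(normSurface d) ≤
      4 * energy p + 4 * K * ∫ x, (a - 1) * hardyWeight a e x ∂(normSurface d) := by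
  have h := hardy_aux ha e p
  have cw := continuous_hardyWeight ha e
  have ct := continuous_height e
  have cp := continuous_restrict p
  set X := ∫ x, hardyWeight a e x * restrict p x ^ 2 ∂(normSurface d) with hX
  set J := ∫ x, (a - 1) * hardyWeight a e x ∂(normSurface d) with hJ
  have hX0 : 0 ≤ X := integral_nonneg fun x =>
    mul_nonneg (hardyWeight_pos ha e x).le (sq_nonneg _)
  have hJ0 : 0 ≤ J := integral_nonneg fun x =>
    mul_nonneg (by linarith) (hardyWeight_pos ha e x).le
  set L := ∫ x, hardyWeight a e x ^ 2 * (1 - height e x ^ 2) * restrict p x ^ 2 ∂(normSurface d) -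
      ((d : ℝ) - 1) * ∫ x, hardyWeight a e x * height e x * restrict p x ^ 2 ∂(normSurface d)
    with hL
  -- For `d = 2`, `w² (1 - t²) - w t = w - (a - 1) (1 + t) w²` exactly. The subtracted term times
  -- `p²` is at most `2 K (a - 1) w`, because `w p² ≤ K` and `1 + t ≤ 2`.
  have hle : X - 2 * K * J ≤ L := by
    rw [hL, hJ, hX, ← integral_const_mul, ← integral_const_mul,
      ← integral_sub (integrable_of_continuous (by fun_prop))
        (integrable_of_continuous (by fun_prop)),
      ← integral_sub (integrable_of_continuous (by fun_prop))
        (integrable_of_continuous (by fun_prop))]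
    refine integral_mono (integrable_of_continuous (by fun_prop))
      (integrable_of_continuous (by fun_prop)) fun x => ?_
    have w0 := hardyWeight_pos ha e x
    have w1 := hardyWeight_mul ha e x
    have t1 := height_le_one e x
    have t2 := neg_one_le_height e x
    have hpx := hp x
    subst hd
    simp only
    set w := hardyWeight a e x
    set t := height e x
    set q := restrict p x ^ 2 with hq
    have hq0 : 0 ≤ q := sq_nonneg _
    have h1 : w * q ≤ K := by
      calc w * q ≤ w * (K * (a - t)) := by
            refine mul_le_mul_of_nonneg_left (hpx.trans ?_) w0.le
            exact mul_le_mul_of_nonneg_left (by linarith) hK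
        _ = K * (w * (a - t)) := by ring
        _ = K := by rw [w1, mul_one]
    have h2 : w ^ 2 * (1 - t ^ 2) - w * t = w - (a - 1) * (1 + t) * w ^ 2 := by
      linear_combination w * (1 + t) * w1
    have h3 : (a - 1) * (1 + t) * w * (w * q) ≤ (a - 1) * 2 * w * K := by
      refine mul_le_mul ?_ h1 (mul_nonneg w0.le hq0)
        (mul_nonneg (mul_nonneg (by linarith) zero_le_two) w0.le)
      refine mul_le_mul_of_nonneg_right ?_ w0.le
      exact mul_le_mul_of_nonneg_left (by linarith) (by linarith)
    have h4 : (w ^ 2 * (1 - t ^ 2) - w * t) * q = (w - (a - 1) * (1 + t) * w ^ 2) * q := by rw [h2]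
    push_cast
    nlinarith
  have hbd : 0 ≤ 4 * K * J := by positivity
  -- If `X > 4 E + 4 K J`, expanding `(X - 2 K J)² ≤ 4 E X` gives `X (X - 4 K J - 4 E) ≤ -4 (K J)²`,
  -- with a positive left-hand side.
  by_contra! hcon
  have hE := energy_nonneg p
  have h5 : 0 ≤ X - 2 * K * J := by nlinarith
  have h6 : (X - 2 * K * J) ^ 2 ≤ 4 * energy p * X := (pow_le_pow_left₀ h5 hle 2).trans h
  have hXpos : 0 < X := by nlinarith
  nlinarith [mul_pos hXpos (sub_pos.2 hcon), sq_nonneg (K * J)]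

/-- The error term on the circle vanishes by dominated convergence: `(a - 1) / (a - t) ≤ 1`, and it
tends to 0 wherever `x ≠ e`. -/
lemma tendsto_integral_sub_one_mul_hardyWeight (hd : 2 ≤ d) (e : Sph d) :
    Tendsto (fun a => ∫ x, (a - 1) * hardyWeight a e x ∂(normSurface d)) (𝓝[>] 1) (𝓝 0) := by
  have h : Tendsto (fun a => ∫ x, (a - 1) * hardyWeight a e x ∂(normSurface d)) (𝓝[>] 1)
      (𝓝 (∫ _x : Sph d, (0 : ℝ) ∂(normSurface d))) := by
    refine tendsto_integral_filter_of_dominated_convergence (fun _ => 1) ?_ ?_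
      (integrable_const _) ?_
    · filter_upwards [self_mem_nhdsWithin] with a ha
      exact ((continuous_hardyWeight ha e).const_mul _).aestronglyMeasurable
    · filter_upwards [self_mem_nhdsWithin] with a ha
      refine Eventually.of_forall fun x => ?_
      have ha' : 1 < a := ha
      have w0 := hardyWeight_pos ha e x
      have w1 := hardyWeight_mul ha e x
      have t1 := height_le_one e x
      rw [Real.norm_eq_abs, abs_of_nonneg (mul_nonneg (by linarith) w0.le)]
      nlinarith
    · have hne : ∀ᵐ x ∂(normSurface d), x ≠ e := by
        rw [ae_iff]
        simpa using normSurface_singleton hd e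
      filter_upwards [hne] with x hx
      have ht : 1 - height e x ≠ 0 := by
        intro h0
        have h1 := norm_sub_sq_eq e x
        rw [h0, mul_zero, sq_eq_zero_iff, norm_eq_zero, sub_eq_zero] at h1
        exact hx (Subtype.ext h1)
      have hc : ContinuousAt (fun a => (a - 1) * hardyWeight a e x) 1 :=
        (continuousAt_id.sub continuousAt_const).mul
          ((continuousAt_id.sub continuousAt_const).inv₀ ht)
      have := hc.tendsto
      rw [sub_self, zero_mul] at this
      exact this.mono_left nhdsWithin_le_nhds
  simpa using h

end Hardy

/-! ### The Hardy-Rellich inequality -/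

section HardyRellich

open MvPolynomial Filter Topology

variable {d : ℕ}

lemma integral_one_sub_height_nonneg (e : Sph d) (g : Sph d → ℝ) :
    0 ≤ ∫ x, (1 - height e x) * g x ^ 2 ∂(normSurface d) :=
  integral_nonneg fun x => mul_nonneg (by linarith [height_le_one e x]) (sq_nonneg _)

/-- The Hardy-Rellich inequality follows from Hardy's inequality by duality. -/
lemma HarmonicBasis.hardyRellich_of_hardy (B : HarmonicBasis d) (hd : 2 ≤ d) (e : Sph d) {K : ℝ}
    (hK : 0 ≤ K) {f g : Sph d → ℝ} (hf : MemLp f 2 (normSurface d))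
    (hg : MemLp g 2 (normSurface d)) (h : IsSqrtNegLaplacian f g)
    (hf0 : ∫ x, f x ∂(normSurface d) = 0)
    (hardy : ∀ (b : B.ι → ℝ) (S : Finset B.ι), (∀ k, B.deg k = 0 → b k = 0) →
      ∃ (c : ℝ) (δ : ℝ → ℝ), Tendsto δ (𝓝[>] 1) (𝓝 0) ∧ ∀ a, 1 < a →
        ∫ x, hardyWeight a e x * restrict (B.comb b S - C c) x ^ 2 ∂(normSurface d) ≤
          K * energy (B.comb b S) + δ a) :
    ∫ x, f x ^ 2 ∂(normSurface d) ≤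
      2 * K * ∫ x, (1 - height e x) * g x ^ 2 ∂(normSurface d) := by
  refine le_of_tendsto' (B.hasSum_coef_sq hf) fun S => ?_
  -- The dual test function: `p = (-Δ₀)^(-1/2)` of the partial sum of `f`, so that `energy p` and
  -- the pairing of `p` with `g` are both given by the partial Parseval sum `s`.
  set b : B.ι → ℝ := fun k => B.coef f k / Real.sqrt (sphEigen d (B.deg k)) with hb
  have hcz : ∀ k, B.deg k = 0 → B.coef f k = 0 := fun k => B.coef_eq_zero_of_deg hf0
  have hpos : ∀ k, B.deg k ≠ 0 → 0 < sphEigen d (B.deg k) := fun k hk => by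
    rw [← sphEigen_zero (d := d)]
    exact sphEigen_strictMono hd (Nat.pos_of_ne_zero hk)
  obtain ⟨c, δ, hδ, hH⟩ := hardy b S fun k hk => by rw [hb]; simp [hcz k hk]
  set p := B.comb b S
  set s := ∑ k ∈ S, B.coef f k ^ 2 with hs
  have hE : energy p = 2 * s := by
    rw [B.energy_comb]
    congr 1
    refine Finset.sum_congr rfl fun k _ => ?_
    by_cases hk : B.deg k = 0
    · simp [hb, hcz k hk]
    · have := hpos k hk
      rw [hb]
      simp only [div_pow, Real.sq_sqrt this.le]
      field_simp
  -- The degree-0 eigenvalue is 0, so `g` has mean zero and subtracting a constant `c` from `p` does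
  -- not change its pairing with `g`.
  have hg0 : ∫ x, g x ∂(normSurface d) = 0 := by
    refine B.integral_eq_zero_of_coef hd hg fun k hk => ?_
    rw [B.coef_eq_of_isSqrtNegLaplacian h, hk, sphEigen_zero]
    simp
  have hpg : ∫ x, restrict (p - C c) x * g x ∂(normSurface d) = s := by
    have e1 : ∀ x, restrict (p - C c) x * g x = restrict p x * g x - c * g x := fun x => by
      rw [restrict_sub, restrict_C]; ring
    simp only [e1]
    have i1 : Integrable (fun x => restrict p x * g x) (normSurface d) :=
      (memLp_restrict p).integrable_mul hg
    rw [integral_sub i1 ((hg.integrable (by norm_num)).const_mul c), integral_const_mul, hg0, mul_zero, sub_zero,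
      B.integral_comb_mul b S hg]
    refine Finset.sum_congr rfl fun k _ => ?_
    rw [B.coef_eq_of_isSqrtNegLaplacian h]
    by_cases hk : B.deg k = 0
    · simp [hcz k hk]
    · have := Real.sqrt_pos.2 (hpos k hk)
      rw [hb]
      field_simp
  have hs0 : 0 ≤ s := Finset.sum_nonneg fun _ _ => sq_nonneg _
  set T := ∫ x, (1 - height e x) * g x ^ 2 ∂(normSurface d) with hT
  have hT0 : 0 ≤ T := integral_one_sub_height_nonneg e g
  set G := ∫ x, g x ^ 2 ∂(normSurface d) with hG
  -- Cauchy-Schwarz for `(√w (p - c)) (√(a - t) g)`, the two weights having product 1, followed by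
  -- Hardy's inequality for the first factor.
  have main : ∀ a, 1 < a → s ^ 2 ≤ ((a - 1) * G + T) * (K * (2 * s) + δ a) := by
    intro a ha
    have cw := continuous_hardyWeight ha e
    have c1 : Continuous fun x => Real.sqrt (hardyWeight a e x) := Real.continuous_sqrt.comp cw
    have c2 : Continuous fun x => Real.sqrt (a - height e x) :=
      Real.continuous_sqrt.comp (continuous_const.sub (continuous_height e))
    have m1 := memLp_continuous_mul c1 (memLp_restrict (p - C c))
    have m2 := memLp_continuous_mul c2 hg
    have hCS := integral_mul_sq_le m1 m2
    have e1 : ∫ x, Real.sqrt (hardyWeight a e x) * restrict (p - C c) x *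
        (Real.sqrt (a - height e x) * g x) ∂(normSurface d) = s := by
      rw [← hpg]
      congr 1
      funext x
      have : Real.sqrt (hardyWeight a e x) * Real.sqrt (a - height e x) = 1 := by
        rw [← Real.sqrt_mul (hardyWeight_pos ha e x).le, hardyWeight_mul ha, Real.sqrt_one]
      linear_combination (restrict (p - C c) x * g x) * this
    have e2 : ∫ x, (Real.sqrt (hardyWeight a e x) * restrict (p - C c) x) ^ 2 ∂(normSurface d) =
        ∫ x, hardyWeight a e x * restrict (p - C c) x ^ 2 ∂(normSurface d) := by
      congr 1
      funext x
      rw [mul_pow, Real.sq_sqrt (hardyWeight_pos ha e x).le]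
    have e3 : ∫ x, (Real.sqrt (a - height e x) * g x) ^ 2 ∂(normSurface d) = (a - 1) * G + T := by
      have i2 : Integrable (fun x => (1 - height e x) * g x ^ 2) (normSurface d) := by
        refine ((memLp_continuous_mul (w := fun x => 1 - height e x)
          (continuous_const.sub (continuous_height e)) hg).integrable_mul hg).congr (Eventually.of_forall fun x => ?_)
        simp only [Pi.mul_apply]
        ring
      rw [hG, hT, ← integral_const_mul, ← integral_add (hg.integrable_sq.const_mul _) i2]
      congr 1
      funext x
      rw [mul_pow, Real.sq_sqrt (sub_height_pos ha e x).le]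
      ring
    rw [e1, e2, e3] at hCS
    have h2 := hH a ha
    rw [hE] at h2
    have hG0 : 0 ≤ G := integral_nonneg fun x => sq_nonneg _
    have h3 : 0 ≤ (a - 1) * G + T := by
      have : 0 ≤ (a - 1) * G := mul_nonneg (by linarith) hG0
      linarith
    calc s ^ 2 ≤ _ := hCS
      _ ≤ (K * (2 * s) + δ a) * ((a - 1) * G + T) := mul_le_mul_of_nonneg_right h2 h3
      _ = _ := mul_comm _ _
  have hlim : Tendsto (fun a => ((a - 1) * G + T) * (K * (2 * s) + δ a)) (𝓝[>] 1)
      (𝓝 (((1 - 1) * G + T) * (K * (2 * s) + 0))) := by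
    have h1 : Tendsto (fun a : ℝ => (a - 1) * G + T) (𝓝[>] 1) (𝓝 ((1 - 1) * G + T)) :=
      (Continuous.tendsto (by fun_prop) 1).mono_left nhdsWithin_le_nhds
    exact h1.mul (hδ.const_add _)
  have hfin : s ^ 2 ≤ T * (K * (2 * s)) := by
    have := ge_of_tendsto hlim (by
      filter_upwards [self_mem_nhdsWithin] with a ha
      exact main a ha)
    simpa using this
  rcases hs0.eq_or_lt with h0 | h0
  · rw [← h0]
    positivity
  · have : s * s ≤ s * (2 * K * T) := by nlinarith
    exact le_of_mul_le_mul_left this h0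

lemma hardyRellich_of_four_le (hd : 4 ≤ d) (e : Sph d) {f g : Sph d → ℝ}
    (hf : MemLp f 2 (normSurface d)) (hg : MemLp g 2 (normSurface d))
    (h : IsSqrtNegLaplacian f g) (hf0 : ∫ x, f x ∂(normSurface d) = 0) :
    ∫ x, f x ^ 2 ∂(normSurface d) ≤
      10 * ∫ x, (1 - height e x) * g x ^ 2 ∂(normSurface d) := by
  have hd2 : 2 ≤ d := by omega
  obtain ⟨B⟩ := nonempty_harmonicBasis hd2
  have h1 := B.hardyRellich_of_hardy hd2 e (K := 5) (by norm_num) hf hg h hf0 fun b S hb => by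
    refine ⟨0, fun _ => 0, tendsto_const_nhds, fun a ha => ?_⟩
    rw [map_zero, sub_zero, add_zero]
    refine hardy_of_four_le hd ha e _ ?_
    have h2 := B.integral_comb_mul_comb b b S
    simp only [← pow_two] at h2
    rw [h2, B.energy_comb, mul_assoc, Finset.mul_sum]
    refine mul_le_mul_of_nonneg_left (Finset.sum_le_sum fun k _ => ?_) zero_le_two
    by_cases hk : B.deg k = 0
    · simp [hb k hk]
    · have h1 : sphEigen d 1 ≤ sphEigen d (B.deg k) :=
        (sphEigen_strictMono hd2).monotone (Nat.one_le_iff_ne_zero.2 hk)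
      have h2 : sphEigen d 1 = (d : ℝ) - 1 := by simp [sphEigen]; ring
      rw [← h2]
      gcongr
  norm_num at h1
  exact h1

lemma hardyRellich_of_eq_two (hd : d = 2) (e : Sph d) {f g : Sph d → ℝ}
    (hf : MemLp f 2 (normSurface d)) (hg : MemLp g 2 (normSurface d))
    (h : IsSqrtNegLaplacian f g) (hf0 : ∫ x, f x ∂(normSurface d) = 0) :
    ∫ x, f x ^ 2 ∂(normSurface d) ≤
      8 * ∫ x, (1 - height e x) * g x ^ 2 ∂(normSurface d) := by
  have hd2 : 2 ≤ d := hd.ge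
  obtain ⟨B⟩ := nonempty_harmonicBasis hd2
  have h1 := B.hardyRellich_of_hardy hd2 e (K := 4) (by norm_num) hf hg h hf0 fun b S hb => by
    set p := B.comb b S
    -- Subtracting the value at `e` makes the function vanish at the pole without changing its
    -- energy.
    obtain ⟨K, hK, hp⟩ := exists_sq_le_of_restrict_eq_zero e (p - C (restrict p e))
      (by rw [restrict_sub, restrict_C, sub_self])
    refine ⟨restrict p e, fun a => 4 * K * ∫ x, (a - 1) * hardyWeight a e x ∂(normSurface d), ?_,
      fun a ha => ?_⟩
    · simpa using (tendsto_integral_sub_one_mul_hardyWeight hd2 e).const_mul (4 * K)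
    · have hE : energy (p - C (restrict p e)) = energy p := by
        have : ∀ i j, angDeriv i j (p - C (restrict p e)) = angDeriv i j p := fun i j => by
          simp [angDeriv_apply]
        simp only [energy, this]
      have := hardy_of_eq_two hd ha e _ hp hK
      rwa [hE] at this
  norm_num at h1
  exact h1

end HardyRellich

/-! ### The tangential gradient of a `C¹` function -/

section Gradient

open MvPolynomial Filter Topology

variable {𝕜 : Type*} [RCLike 𝕜] {d : ℕ}

lemma sph_ne_zero (x : Sph d) : (x : EuclideanSpace ℝ (Fin d)) ≠ 0 := by
  intro h
  have := x.2
  simp [h] at this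

lemma radialExt_coe (f : Sph d → 𝕜) (x : Sph d) : radialExt f x = f x := by
  have h : ‖(x : EuclideanSpace ℝ (Fin d))‖⁻¹ • (x : EuclideanSpace ℝ (Fin d)) = x := by simp
  simp [radialExt]

open Classical in
lemma radialExt_smul (f : Sph d → 𝕜) {r : ℝ} (hr : 0 < r) (y : EuclideanSpace ℝ (Fin d)) :
    radialExt f (r • y) = radialExt f y := by
  have h : ‖r • y‖⁻¹ • r • y = ‖y‖⁻¹ • y := by
    rw [norm_smul, smul_smul, Real.norm_eq_abs, abs_of_pos hr]
    congr 1
    field_simp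
  exact congrArg (fun z : EuclideanSpace ℝ (Fin d) =>
    if hz : z ∈ Metric.sphere (0 : EuclideanSpace ℝ (Fin d)) 1 then f ⟨z, hz⟩ else 0) h

lemma IsC1.contDiffAt {f : Sph d → 𝕜} (hf : IsC1 f) (x : Sph d) :
    ContDiffAt ℝ 1 (radialExt f) (x : EuclideanSpace ℝ (Fin d)) :=
  ContDiffOn.contDiffAt hf (isOpen_compl_singleton.mem_nhds (sph_ne_zero x))

lemma IsC1.continuous {f : Sph d → 𝕜} (hf : IsC1 f) : Continuous f := by
  rw [continuous_iff_continuousAt]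
  intro x
  have h := ContinuousAt.comp (f := ((↑) : Sph d → EuclideanSpace ℝ (Fin d)))
    (hf.contDiffAt x).continuousAt continuousAt_subtype_val
  exact h.congr (Eventually.of_forall fun y => radialExt_coe f y)

/-- The extension is constant along rays, so its radial derivative vanishes. -/
lemma IsC1.fderiv_radialExt_self {f : Sph d → 𝕜} (hf : IsC1 f) (x : Sph d) :
    fderiv ℝ (radialExt f) x (x : EuclideanSpace ℝ (Fin d)) = 0 := by
  have h1 : HasDerivAt (fun s : ℝ => s • (x : EuclideanSpace ℝ (Fin d)))
      (x : EuclideanSpace ℝ (Fin d)) 1 := by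
    simpa using (hasDerivAt_id (1 : ℝ)).smul_const (x : EuclideanSpace ℝ (Fin d))
  have h2 : HasFDerivAt (radialExt f) (fderiv ℝ (radialExt f) x)
      ((1 : ℝ) • (x : EuclideanSpace ℝ (Fin d))) := by
    rw [one_smul]
    exact ((hf.contDiffAt x).differentiableAt (by norm_num)).hasFDerivAt
  have h3 := h2.comp_hasDerivAt (1 : ℝ) h1
  have h4 : (radialExt f ∘ fun s : ℝ => s • (x : EuclideanSpace ℝ (Fin d))) =ᶠ[𝓝 1]
      fun _ => radialExt f x := by
    filter_upwards [lt_mem_nhds (zero_lt_one' ℝ)] with s hs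
    exact radialExt_smul f hs _
  exact h3.unique ((hasDerivAt_const (1 : ℝ) (radialExt f x)).congr_of_eventuallyEq h4)

/-- The angular derivative of a real function on the sphere. -/
def angFun (u : Sph d → ℝ) (i j : Fin d) (x : Sph d) : ℝ :=
  fderiv ℝ (radialExt u) x (infRot i j x)

lemma IsC1.continuous_angFun {u : Sph d → ℝ} (hu : IsC1 u) (i j : Fin d) :
    Continuous (angFun u i j) :=
  (continuous_fderiv_sphere hu.contDiffAt).clm_apply
    ((infRot i j).continuous.comp continuous_subtype_val)

/-- Lagrange's identity for `x` and the gradient, which are orthogonal by `fderiv_radialExt_self`.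
-/
lemma IsC1.sum_angFun_sq {u : Sph d → ℝ} (hu : IsC1 u) (x : Sph d) :
    ∑ i, ∑ j, angFun u i j x ^ 2 = 2 * tangentGradSq u x := by
  have h : ∀ i j, angFun u i j x = (x : EuclideanSpace ℝ (Fin d)) i *
      fderiv ℝ (radialExt u) x (EuclideanSpace.single j 1) -
      (x : EuclideanSpace ℝ (Fin d)) j *
      fderiv ℝ (radialExt u) x (EuclideanSpace.single i 1) := by
    intro i j
    rw [angFun, infRot_apply, map_sub, map_smul, map_smul, smul_eq_mul, smul_eq_mul]
  have h0 : ∑ i, (x : EuclideanSpace ℝ (Fin d)) i *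
      fderiv ℝ (radialExt u) x (EuclideanSpace.single i 1) = 0 := by
    rw [← hu.fderiv_radialExt_self x]
    have hx : (x : EuclideanSpace ℝ (Fin d)) = ∑ i, (x : EuclideanSpace ℝ (Fin d)) i •
        EuclideanSpace.single i (1 : ℝ) := by
      ext k
      simp [Pi.single_apply]
    conv_rhs => rw [congrArg (fderiv ℝ (radialExt u) x) hx]
    simp
  simp only [h]
  rw [sum_sum_sub_sq, sum_sq_sph, h0]
  simp [tangentGradSq]

lemma IsC1.integrable_tangentGradSq {u : Sph d → ℝ} (hu : IsC1 u) :
    Integrable (tangentGradSq u) (normSurface d) := by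
  have h : tangentGradSq u = fun x => 2⁻¹ * ∑ i, ∑ j, angFun u i j x ^ 2 := by
    funext x
    rw [hu.sum_angFun_sq]
    ring
  rw [h]
  exact integrable_of_continuous (continuous_const.mul (continuous_finsetSum _ fun i _ =>
    continuous_finsetSum _ fun j _ => (hu.continuous_angFun i j).pow 2))

/-! ### Truncation by degree and the Dirichlet integral of a `C¹` function. -/

namespace HarmonicBasis

variable (B : HarmonicBasis d)

lemma finite_deg_le (N : ℕ) : {k | B.deg k ≤ N}.Finite :=
  ((Set.finite_Iic N).biUnion fun n _ => B.finite_deg n).subset fun k (hk : B.deg k ≤ N) =>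
    Set.mem_biUnion (Set.mem_Iic.2 hk) rfl

/-- The indices of degree at most `N`. -/
def degLE (N : ℕ) : Finset B.ι := (B.finite_deg_le N).toFinset

lemma mem_degLE {N : ℕ} {k : B.ι} : k ∈ B.degLE N ↔ B.deg k ≤ N := by simp [degLE]

lemma tendsto_degLE : Tendsto B.degLE atTop atTop := by
  refine tendsto_atTop_finset_of_monotone (fun m n h k hk => ?_) fun k => ⟨B.deg k, ?_⟩
  · rw [mem_degLE] at *
    exact hk.trans h
  · rw [mem_degLE]

lemma coef_angFun {u : Sph d → ℝ} (hu : IsC1 u) (i j : Fin d) (k : B.ι) :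
    B.coef (angFun u i j) k =
      - ∫ x, u x * restrict (angDeriv i j (B.poly k)) x ∂(normSurface d) := by
  have h := integral_fderiv_infRot_mul hu.contDiffAt (B.poly k) i j
  simp only [radialExt_coe] at h
  rw [← h, coef]
  congr 1
  funext x
  exact mul_comm _ _

/-- `D_ij` preserves the degree of a harmonic, so pairing with `D_ij` of a basis element sees either
all the relevant coefficients of `u` or none. This is why the truncation is by degree and not by an
arbitrary finite set. -/
lemma integral_comb_degLE_mul (hd : 2 ≤ d) {u : Sph d → ℝ} (hu : MemLp u 2 (normSurface d))
    (N : ℕ) (i j : Fin d) (k : B.ι) :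
    ∫ x, restrict (B.comb (B.coef u) (B.degLE N)) x * restrict (angDeriv i j (B.poly k)) x
      ∂(normSurface d) =
      if B.deg k ≤ N then ∫ x, u x * restrict (angDeriv i j (B.poly k)) x ∂(normSurface d)
      else 0 := by
  have hz : ∀ l, B.deg l ≠ B.deg k → B.coef (restrict (angDeriv i j (B.poly k))) l = 0 :=
    fun l hl => B.coef_restrict_eq_zero hd (angDeriv_mem_harmSub (B.mem_harmSub k) i j) hl
  rw [B.integral_comb_mul _ _ (memLp_restrict _)]
  split_ifs with hk
  · refine HasSum.unique ?_ (B.hasSum_coef_mul hu (memLp_restrict _))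
    refine hasSum_sum_of_ne_finset_zero fun l hl => ?_
    rw [hz l fun h => hl (B.mem_degLE.2 (h ▸ hk)), mul_zero]
  · refine Finset.sum_eq_zero fun l hl => ?_
    rw [hz l fun h => hk (h ▸ B.mem_degLE.1 hl), mul_zero]

/-- Truncation by degree commutes with `D_ij`; apply Parseval to the truncated derivative. -/
lemma sum_degLE_coef_angFun_sq (hd : 2 ≤ d) {u : Sph d → ℝ} (hu : IsC1 u) (N : ℕ) (i j : Fin d) :
    ∑ k ∈ B.degLE N, B.coef (angFun u i j) k ^ 2 =
      ∫ x, restrict (angDeriv i j (B.comb (B.coef u) (B.degLE N))) x ^ 2 ∂(normSurface d) := by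
  have hum := memLp_of_continuous hu.continuous
  set p := B.comb (B.coef u) (B.degLE N) with hp
  have h : ∀ k, B.coef (restrict (angDeriv i j p)) k =
      if B.deg k ≤ N then B.coef (angFun u i j) k else 0 := by
    intro k
    have h1 := integral_angDeriv_mul p (B.poly k) i j
    rw [hp, B.integral_comb_degLE_mul hd hum] at h1
    have h2 : B.coef (restrict (angDeriv i j p)) k =
        ∫ x, restrict (angDeriv i j p) x * restrict (B.poly k) x ∂(normSurface d) := by
      rw [coef]
      congr 1
      funext x
      exact mul_comm _ _
    rw [h2, h1, B.coef_angFun hu]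
    split_ifs <;> simp
  refine HasSum.unique ?_ (B.hasSum_coef_sq (memLp_restrict _))
  have h3 : ∑ k ∈ B.degLE N, B.coef (angFun u i j) k ^ 2 =
      ∑ k ∈ B.degLE N, B.coef (restrict (angDeriv i j p)) k ^ 2 :=
    Finset.sum_congr rfl fun k hk => by rw [h, if_pos (B.mem_degLE.1 hk)]
  rw [h3]
  refine hasSum_sum_of_ne_finset_zero fun k hk => ?_
  rw [h, if_neg fun h => hk (B.mem_degLE.2 h)]
  simp

/-- Up to degree `N`, the squared coefficients of all `D_ij u` add up to twice those of `g`, both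
being the Dirichlet form of the truncation; let `N` tend to infinity. -/
lemma integral_sq_eq_integral_tangentGradSq (B : HarmonicBasis d) (hd : 2 ≤ d) {u g : Sph d → ℝ} (hu : IsC1 u)
    (hg : MemLp g 2 (normSurface d)) (h : IsSqrtNegLaplacian u g) :
    ∫ x, g x ^ 2 ∂(normSurface d) = ∫ x, tangentGradSq u x ∂(normSurface d) := by
  have l1 : Tendsto (fun N => ∑ i, ∑ j, ∑ k ∈ B.degLE N, B.coef (angFun u i j) k ^ 2) atTop
      (𝓝 (∑ i, ∑ j, ∫ x, angFun u i j x ^ 2 ∂(normSurface d))) :=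
    tendsto_finsetSum _ fun i _ => tendsto_finsetSum _ fun j _ =>
      (B.hasSum_coef_sq (memLp_of_continuous (hu.continuous_angFun i j))).comp B.tendsto_degLE
  have l2 : Tendsto (fun N => 2 * ∑ k ∈ B.degLE N, B.coef g k ^ 2) atTop
      (𝓝 (2 * ∫ x, g x ^ 2 ∂(normSurface d))) :=
    (Tendsto.comp (B.hasSum_coef_sq hg) B.tendsto_degLE).const_mul 2
  have heq : (fun N => ∑ i, ∑ j, ∑ k ∈ B.degLE N, B.coef (angFun u i j) k ^ 2) =
      fun N => 2 * ∑ k ∈ B.degLE N, B.coef g k ^ 2 := by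
    funext N
    simp only [B.sum_degLE_coef_angFun_sq hd hu, B.sum_integral_angDeriv_comb_sq,
      B.coef_sq_eq_of_isSqrtNegLaplacian hd h]
  rw [heq] at l1
  have h1 := tendsto_nhds_unique l2 l1
  rw [sum_integral_eq (f := fun i j x => angFun u i j x ^ 2)
    fun i j => (hu.continuous_angFun i j).pow 2] at h1
  simp only [hu.sum_angFun_sq, integral_const_mul] at h1
  linarith

end HarmonicBasis

end Gradient

/-! ### Real and imaginary parts -/

section ReIm

open Filter Topology

variable {𝕜 : Type*} [RCLike 𝕜] {d : ℕ}

lemma norm_sq_eq_re_sq_add_im_sq (z : 𝕜) : ‖z‖ ^ 2 = RCLike.re z ^ 2 + RCLike.im z ^ 2 := by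
  rw [RCLike.norm_sq_eq_def]; ring

lemma integrable_mul_norm_sq {w : Sph d → ℝ} (hw : Continuous w) {f : Sph d → 𝕜}
    (hf : MemLp f 2 (normSurface d)) :
    Integrable (fun x => w x * ‖f x‖ ^ 2) (normSurface d) := by
  refine ((memLp_continuous_mul hw hf.norm).integrable_mul hf.norm).congr
    (Eventually.of_forall fun x => ?_)
  simp only [Pi.mul_apply]
  ring

lemma integral_mul_norm_sq {w : Sph d → ℝ} (hw : Continuous w) {f : Sph d → 𝕜}
    (hf : MemLp f 2 (normSurface d)) :
    ∫ x, w x * ‖f x‖ ^ 2 ∂(normSurface d) =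
      ∫ x, w x * RCLike.re (f x) ^ 2 ∂(normSurface d) +
        ∫ x, w x * RCLike.im (f x) ^ 2 ∂(normSurface d) := by
  have h : ∀ u : Sph d → ℝ, MemLp u 2 (normSurface d) →
      Integrable (fun x => w x * u x ^ 2) (normSurface d) := fun u hu => by
    simpa using integrable_mul_norm_sq (𝕜 := ℝ) hw hu
  rw [← integral_add (h _ hf.re) (h _ hf.im)]
  congr 1
  funext x
  rw [norm_sq_eq_re_sq_add_im_sq, mul_add]

lemma integral_norm_sq {f : Sph d → 𝕜} (hf : MemLp f 2 (normSurface d)) :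
    ∫ x, ‖f x‖ ^ 2 ∂(normSurface d) =
      ∫ x, RCLike.re (f x) ^ 2 ∂(normSurface d) + ∫ x, RCLike.im (f x) ^ 2 ∂(normSurface d) := by
  simpa using integral_mul_norm_sq (w := fun _ => 1) continuous_const hf

lemma integrable_restrict_smul (p : MvPolynomial (Fin d) ℝ) {f : Sph d → 𝕜}
    (hf : MemLp f 2 (normSurface d)) :
    Integrable (fun x => restrict p x • f x) (normSurface d) :=
  memLp_one_iff_integrable.1 (hf.smul (memLp_restrict p))

lemma IsSqrtNegLaplacian.re {f g : Sph d → 𝕜} (h : IsSqrtNegLaplacian f g)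
    (hf : MemLp f 2 (normSurface d)) (hg : MemLp g 2 (normSurface d)) :
    IsSqrtNegLaplacian (fun x => RCLike.re (f x)) (fun x => RCLike.re (g x)) := by
  rintro n _ ⟨p, hp1, hp2, rfl⟩
  have h1 := congrArg RCLike.re (h n _ ⟨p, hp1, hp2, rfl⟩)
  rw [RCLike.smul_re, ← integral_re (integrable_restrict_smul p hf),
    ← integral_re (integrable_restrict_smul p hg)] at h1
  simpa only [RCLike.smul_re, smul_eq_mul] using h1

lemma IsSqrtNegLaplacian.im {f g : Sph d → 𝕜} (h : IsSqrtNegLaplacian f g)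
    (hf : MemLp f 2 (normSurface d)) (hg : MemLp g 2 (normSurface d)) :
    IsSqrtNegLaplacian (fun x => RCLike.im (f x)) (fun x => RCLike.im (g x)) := by
  rintro n _ ⟨p, hp1, hp2, rfl⟩
  have h1 := congrArg RCLike.im (h n _ ⟨p, hp1, hp2, rfl⟩)
  rw [RCLike.smul_im, ← integral_im (integrable_restrict_smul p hf),
    ← integral_im (integrable_restrict_smul p hg)] at h1
  simpa only [RCLike.smul_im, smul_eq_mul] using h1

lemma integral_re_eq_zero {f : Sph d → 𝕜} (hf : MemLp f 2 (normSurface d))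
    (h : ∫ x, f x ∂(normSurface d) = 0) : ∫ x, RCLike.re (f x) ∂(normSurface d) = 0 := by
  rw [integral_re (hf.integrable (by norm_num)), h, map_zero]

lemma integral_im_eq_zero {f : Sph d → 𝕜} (hf : MemLp f 2 (normSurface d))
    (h : ∫ x, f x ∂(normSurface d) = 0) : ∫ x, RCLike.im (f x) ∂(normSurface d) = 0 := by
  rw [integral_im (hf.integrable (by norm_num)), h, map_zero]

lemma MemSobolev.sqrtNegLaplacian_spec {f : Sph d → 𝕜} (hf : MemSobolev f) :
    MemLp (sqrtNegLaplacian f) 2 (normSurface d) ∧ IsSqrtNegLaplacian f (sqrtNegLaplacian f) := by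
  rw [sqrtNegLaplacian, dif_pos hf.2]
  exact hf.2.choose_spec

lemma gradNorm_sq (f : Sph d → 𝕜) :
    gradNorm f ^ 2 = ∫ x, ‖sqrtNegLaplacian f x‖ ^ 2 ∂(normSurface d) :=
  Real.sq_sqrt (integral_nonneg fun _ => sq_nonneg _)

/-- `sqrtNegLaplacian` is an arbitrary choice, so identifying it with an explicit function requires
this uniqueness. -/
lemma ae_eq_of_isSqrtNegLaplacian (hd : 2 ≤ d) {f g h : Sph d → 𝕜}
    (hf : MemLp f 2 (normSurface d)) (hg : MemLp g 2 (normSurface d))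
    (hh : MemLp h 2 (normSurface d)) (h1 : IsSqrtNegLaplacian f g)
    (h2 : IsSqrtNegLaplacian f h) : g =ᵐ[normSurface d] h := by
  obtain ⟨B⟩ := nonempty_harmonicBasis hd
  have hre := B.ae_eq_of_coef hg.re hh.re fun k => by
    rw [B.coef_eq_of_isSqrtNegLaplacian (h1.re hf hg), B.coef_eq_of_isSqrtNegLaplacian (h2.re hf hh)]
  have him := B.ae_eq_of_coef hg.im hh.im fun k => by
    rw [B.coef_eq_of_isSqrtNegLaplacian (h1.im hf hg), B.coef_eq_of_isSqrtNegLaplacian (h2.im hf hh)]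
  filter_upwards [hre, him] with x h3 h4
  exact RCLike.ext h3 h4

lemma integral_restrict_smul_ofReal_add (p : MvPolynomial (Fin d) ℝ) {u v : Sph d → ℝ}
    (hu : MemLp u 2 (normSurface d)) (hv : MemLp v 2 (normSurface d)) :
    ∫ x, restrict p x • ((u x : 𝕜) + (v x : 𝕜) * RCLike.I) ∂(normSurface d) =
      ((∫ x, restrict p x * u x ∂(normSurface d) : ℝ) : 𝕜) +
        ((∫ x, restrict p x * v x ∂(normSurface d) : ℝ) : 𝕜) * RCLike.I := by
  have i1 : Integrable (fun x => restrict p x * u x) (normSurface d) :=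
    (memLp_restrict p).integrable_mul hu
  have i2 : Integrable (fun x => restrict p x * v x) (normSurface d) :=
    (memLp_restrict p).integrable_mul hv
  have j1 : Integrable (fun x => ((restrict p x * u x : ℝ) : 𝕜)) (normSurface d) := i1.ofReal
  have j2 : Integrable (fun x => ((restrict p x * v x : ℝ) : 𝕜) * RCLike.I) (normSurface d) :=
    i2.ofReal.mul_const _
  rw [← integral_ofReal, ← integral_ofReal, ← integral_mul_const, ← integral_add j1 j2]
  congr 1
  funext x
  rw [RCLike.real_smul_eq_coe_mul, RCLike.ofReal_mul, RCLike.ofReal_mul]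
  ring

lemma isSqrtNegLaplacian_ofReal_add {a b u v : Sph d → ℝ}
    (ha : MemLp a 2 (normSurface d)) (hb : MemLp b 2 (normSurface d))
    (hu : MemLp u 2 (normSurface d)) (hv : MemLp v 2 (normSurface d))
    (h1 : IsSqrtNegLaplacian a u) (h2 : IsSqrtNegLaplacian b v) :
    IsSqrtNegLaplacian (fun x => (a x : 𝕜) + (b x : 𝕜) * RCLike.I)
      (fun x => (u x : 𝕜) + (v x : 𝕜) * RCLike.I) := by
  rintro n _ ⟨p, hp1, hp2, rfl⟩
  have h1 := h1 n _ ⟨p, hp1, hp2, rfl⟩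
  have h2 := h2 n _ ⟨p, hp1, hp2, rfl⟩
  simp only [smul_eq_mul] at h1 h2
  rw [integral_restrict_smul_ofReal_add p ha hb, integral_restrict_smul_ofReal_add p hu hv, h1, h2,
    RCLike.real_smul_eq_coe_mul, RCLike.ofReal_mul, RCLike.ofReal_mul]
  ring

/-- Existence of `(-Δ₀)^(-1/2) f`. -/
lemma exists_isSqrtNegLaplacian (hd : 2 ≤ d) {f : Sph d → 𝕜} (hf : MemLp f 2 (normSurface d))
    (hf0 : ∫ x, f x ∂(normSurface d) = 0) :
    ∃ g : Sph d → 𝕜, MemLp g 2 (normSurface d) ∧ ∫ x, g x ∂(normSurface d) = 0 ∧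
      IsSqrtNegLaplacian g f := by
  obtain ⟨B⟩ := nonempty_harmonicBasis hd
  obtain ⟨a, ha, ha0, ha1⟩ := B.exists_isSqrtNegLaplacian hd hf.re (integral_re_eq_zero hf hf0)
  obtain ⟨b, hb, hb0, hb1⟩ := B.exists_isSqrtNegLaplacian hd hf.im (integral_im_eq_zero hf hf0)
  have hm : MemLp (fun x => (a x : 𝕜) + (b x : 𝕜) * RCLike.I) 2 (normSurface d) :=
    MemLp.add (f := fun x => (a x : 𝕜)) (g := fun x => (b x : 𝕜) * RCLike.I) ha.ofReal
      (MemLp.mul_const (f := fun x => (b x : 𝕜)) hb.ofReal RCLike.I)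
  refine ⟨fun x => (a x : 𝕜) + (b x : 𝕜) * RCLike.I, hm, ?_, ?_⟩
  · have h := integral_restrict_smul_ofReal_add (𝕜 := 𝕜) (MvPolynomial.C 1) ha hb
    simpa only [restrict_C, one_smul, one_mul, ha0, hb0, RCLike.ofReal_zero, zero_mul,
      add_zero] using h
  · have h := isSqrtNegLaplacian_ofReal_add (𝕜 := 𝕜) ha hb hf.re hf.im ha1 hb1
    simpa only [RCLike.re_add_im] using h

lemma radialExt_comp {F : Type*} [RCLike F] (L : 𝕜 →L[ℝ] F) (f : Sph d → 𝕜) :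
    radialExt (fun x => L (f x)) = fun y => L (radialExt f y) := by
  funext y
  unfold radialExt
  split_ifs <;> simp

lemma IsC1.comp {F : Type*} [RCLike F] (L : 𝕜 →L[ℝ] F) {f : Sph d → 𝕜} (hf : IsC1 f) :
    IsC1 (fun x => L (f x)) := by
  unfold IsC1
  rw [radialExt_comp]
  exact L.contDiff.comp_contDiffOn hf

lemma IsC1.tangentGradSq_eq {f : Sph d → 𝕜} (hf : IsC1 f) (x : Sph d) :
    tangentGradSq f x = tangentGradSq (fun x => RCLike.re (f x)) x +
      tangentGradSq (fun x => RCLike.im (f x)) x := by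
  have h : ∀ (L : 𝕜 →L[ℝ] ℝ) (v : EuclideanSpace ℝ (Fin d)),
      fderiv ℝ (radialExt fun x => L (f x)) x v = L (fderiv ℝ (radialExt f) x v) := by
    intro L v
    have h0 := L.hasFDerivAt.comp (x : EuclideanSpace ℝ (Fin d))
      ((hf.contDiffAt x).differentiableAt (by norm_num)).hasFDerivAt
    rw [radialExt_comp]
    exact congrArg (fun A => A v) h0.fderiv
  have h1 := h RCLike.reCLM
  have h2 := h RCLike.imCLM
  simp only [RCLike.reCLM_apply, RCLike.imCLM_apply] at h1 h2
  simp only [tangentGradSq, h1, h2, ← Finset.sum_add_distrib, norm_sq_eq_re_sq_add_im_sq,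
    Real.norm_eq_abs, sq_abs]

lemma gradNorm_sq_eq_integral_tangentGradSq (hd : 2 ≤ d) {f : Sph d → 𝕜} (hf : MemSobolev f)
    (h : IsC1 f) : gradNorm f ^ 2 = ∫ x, tangentGradSq f x ∂(normSurface d) := by
  obtain ⟨B⟩ := nonempty_harmonicBasis hd
  obtain ⟨hg, hs⟩ := hf.sqrtNegLaplacian_spec
  have hre : IsC1 fun x => RCLike.re (f x) := h.comp RCLike.reCLM
  have him : IsC1 fun x => RCLike.im (f x) := h.comp RCLike.imCLM
  simp only [h.tangentGradSq_eq]
  rw [gradNorm_sq, integral_norm_sq hg,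
    integral_add hre.integrable_tangentGradSq him.integrable_tangentGradSq,
    B.integral_sq_eq_integral_tangentGradSq hd hre hg.re (hs.re hf.1 hg),
    B.integral_sq_eq_integral_tangentGradSq hd him hg.im (hs.im hf.1 hg)]

/-- Both sides split into the contributions of real and imaginary parts, and the operator acts on
each part separately. -/
lemma isHardyRellichConst_of_real {C : ℝ}
    (hC : ∀ (e : Sph d) {f g : Sph d → ℝ}, MemLp f 2 (normSurface d) → MemLp g 2 (normSurface d) →
      IsSqrtNegLaplacian f g → ∫ x, f x ∂(normSurface d) = 0 →
      ∫ x, f x ^ 2 ∂(normSurface d) ≤ C * ∫ x, (1 - height e x) * g x ^ 2 ∂(normSurface d)) :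
    IsHardyRellichConst 𝕜 d C := by
  intro f hf hf0 e
  obtain ⟨hg, hs⟩ := hf.sqrtNegLaplacian_spec
  have h := integral_mul_norm_sq (w := fun x => 1 - height e x)
    (continuous_const.sub (continuous_height e)) hg
  change _ ≤ C * ∫ x, (1 - height e x) * ‖sqrtNegLaplacian f x‖ ^ 2 ∂(normSurface d)
  rw [h, integral_norm_sq hf.1, mul_add]
  exact add_le_add
    (hC e hf.1.re hg.re (hs.re hf.1 hg) (integral_re_eq_zero hf.1 hf0))
    (hC e hf.1.im hg.im (hs.im hf.1 hg) (integral_im_eq_zero hf.1 hf0))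

lemma isHardyRellichConst_eight (hd : d = 2) : IsHardyRellichConst 𝕜 d 8 :=
  isHardyRellichConst_of_real fun e _ _ => hardyRellich_of_eq_two hd e

lemma isHardyRellichConst_ten (hd : 4 ≤ d) : IsHardyRellichConst 𝕜 d 10 :=
  isHardyRellichConst_of_real fun e _ _ => hardyRellich_of_four_le hd e

end ReIm

/-! ### The uncertainty principle -/

section Uncertainty

open Filter Topology

variable {𝕜 : Type*} [RCLike 𝕜] {d : ℕ}

lemma inner_tau {f : Sph d → 𝕜} (hf : MemLp f 2 (normSurface d)) (e : Sph d) :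
    inner ℝ (tau f) (e : EuclideanSpace ℝ (Fin d)) =
      ∫ x, height e x * ‖f x‖ ^ 2 ∂(normSurface d) := by
  have hi : Integrable (fun x : Sph d => (‖f x‖ ^ 2) • (x : EuclideanSpace ℝ (Fin d)))
      (normSurface d) := by
    have h1 : Integrable (fun x : Sph d => ‖f x‖ ^ 2) (normSurface d) := by
      simpa using integrable_mul_norm_sq (w := fun _ => 1) continuous_const hf
    refine h1.mono' (h1.aestronglyMeasurable.smul
      continuous_subtype_val.aestronglyMeasurable) (Eventually.of_forall fun x => ?_)
    rw [norm_smul]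
    simp
  rw [tau, real_inner_comm, ← integral_inner hi]
  congr 1
  funext x
  rw [inner_smul_right, height, real_inner_comm, mul_comm]

lemma integral_norm_sq_eq_one {f : Sph d → 𝕜} (h : l2Norm f = 1) :
    ∫ x, ‖f x‖ ^ 2 ∂(normSurface d) = 1 := Real.sqrt_eq_one.1 h

lemma integral_one_sub_height_mul {f : Sph d → 𝕜} (hf : MemLp f 2 (normSurface d))
    (h : l2Norm f = 1) (e : Sph d) :
    ∫ x, (1 - height e x) * ‖f x‖ ^ 2 ∂(normSurface d) =
      1 - inner ℝ (tau f) (e : EuclideanSpace ℝ (Fin d)) := by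
  have i1 : Integrable (fun x : Sph d => ‖f x‖ ^ 2) (normSurface d) := by
    simpa using integrable_mul_norm_sq (w := fun _ => 1) continuous_const hf
  have h1 := integral_sub i1 (integrable_mul_norm_sq (continuous_height e) hf)
  rw [integral_norm_sq_eq_one h] at h1
  rw [inner_tau hf, ← h1]
  congr 1
  funext x
  ring

lemma exists_inner_tau_eq_norm (hd : 2 ≤ d) (f : Sph d → 𝕜) :
    ∃ e : Sph d, inner ℝ (tau f) (e : EuclideanSpace ℝ (Fin d)) = ‖tau f‖ := by
  by_cases h : tau f = 0
  · have := nontrivial_euclidean hd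
    obtain ⟨v, hv⟩ := exists_norm_eq (EuclideanSpace ℝ (Fin d)) zero_le_one
    exact ⟨⟨v, by simpa using hv⟩, by simp [h]⟩
  · have h0 : ‖tau f‖ ≠ 0 := norm_ne_zero_iff.2 h
    refine ⟨⟨‖tau f‖⁻¹ • tau f, by simp [norm_smul, h0]⟩, ?_⟩
    rw [inner_smul_right, real_inner_self_eq_norm_sq]
    field_simp

lemma isLeast_one_sub_norm_tau (hd : 2 ≤ d) {f : Sph d → 𝕜} (hf : MemLp f 2 (normSurface d))
    (h : l2Norm f = 1) :
    IsLeast (Set.range fun e : Sph d => ∫ x, (1 - height e x) * ‖f x‖ ^ 2 ∂(normSurface d))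
      (1 - ‖tau f‖) := by
  simp only [integral_one_sub_height_mul hf h]
  constructor
  · obtain ⟨e, he⟩ := exists_inner_tau_eq_norm hd f
    exact ⟨e, by simp only [he]⟩
  · rintro _ ⟨e, rfl⟩
    have := real_inner_le_norm (tau f) (e : EuclideanSpace ℝ (Fin d))
    simp only [norm_eq_of_mem_sphere, mul_one] at this
    simp only
    linarith

/-- Cauchy-Schwarz in the plane. It merges the quadratic inequalities for real and imaginary parts
without loss in the constant. -/
lemma add_sq_le_of_sq_le {a b x y z w : ℝ} (hx : 0 ≤ x) (hy : 0 ≤ y) (hz : 0 ≤ z) (hw : 0 ≤ w)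
    (h1 : a ^ 2 ≤ x * y) (h2 : b ^ 2 ≤ z * w) : (a + b) ^ 2 ≤ (x + z) * (y + w) := by
  have h := Finset.sum_sq_le_sum_mul_sum_of_sq_le_mul (Finset.univ : Finset (Fin 2))
    (r := ![a, b]) (f := ![x, z]) (g := ![y, w])
    (by simp [Fin.forall_fin_two, hx, hz]) (by simp [Fin.forall_fin_two, hy, hw])
    (by simp [Fin.forall_fin_two, h1, h2])
  simpa using h

lemma sub_one_sq_mul_norm_tau_sq_le (hd : 2 ≤ d) {f : Sph d → 𝕜} (hf : MemSobolev f)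
    (h : l2Norm f = 1) :
    ((d : ℝ) - 1) ^ 2 * ‖tau f‖ ^ 2 ≤ 4 * gradNorm f ^ 2 * (1 - ‖tau f‖ ^ 2) := by
  obtain ⟨hg, hs⟩ := hf.sqrtNegLaplacian_spec
  obtain ⟨e, he⟩ := exists_inner_tau_eq_norm hd f
  set τ := ‖tau f‖
  have ct := continuous_height e
  have cq : Continuous fun x => 1 - height e x ^ 2 := continuous_const.sub (ct.pow 2)
  have hτ : ∫ x, height e x * ‖f x‖ ^ 2 ∂(normSurface d) = τ := by rw [← inner_tau hf.1, he]
  -- The variance of `t` under the probability density `|f|²`, which has mean `τ`, is nonnegative.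
  have hW : ∫ x, (1 - height e x ^ 2) * ‖f x‖ ^ 2 ∂(normSurface d) ≤ 1 - τ ^ 2 := by
    have h0 : 0 ≤ ∫ x, (height e x - τ) ^ 2 * ‖f x‖ ^ 2 ∂(normSurface d) :=
      integral_nonneg fun x => mul_nonneg (sq_nonneg _) (sq_nonneg _)
    have e1 : ∀ x, (height e x - τ) ^ 2 * ‖f x‖ ^ 2 = (1 + τ ^ 2) * ‖f x‖ ^ 2 -
        2 * τ * (height e x * ‖f x‖ ^ 2) - (1 - height e x ^ 2) * ‖f x‖ ^ 2 := fun x => by ring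
    have i1 : Integrable (fun x => (1 + τ ^ 2) * ‖f x‖ ^ 2) (normSurface d) :=
      integrable_mul_norm_sq continuous_const hf.1
    have i2 : Integrable (fun x => 2 * τ * (height e x * ‖f x‖ ^ 2)) (normSurface d) :=
      (integrable_mul_norm_sq ct hf.1).const_mul _
    have i12 : Integrable (fun x => (1 + τ ^ 2) * ‖f x‖ ^ 2 - 2 * τ * (height e x * ‖f x‖ ^ 2))
      (normSurface d) := i1.sub i2
    simp only [e1] at h0
    rw [integral_sub i12 (integrable_mul_norm_sq cq hf.1), integral_sub i1 i2,
      integral_const_mul, integral_const_mul, hτ, integral_norm_sq_eq_one h] at h0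
    linarith
  have hq : ∀ x, 0 ≤ 1 - height e x ^ 2 := fun x => by
    nlinarith [height_le_one e x, neg_one_le_height e x]
  have n1 : ∀ u : Sph d → ℝ, 0 ≤ 4 * ∫ x, u x ^ 2 ∂(normSurface d) := fun u =>
    mul_nonneg (by norm_num) (integral_nonneg fun x => sq_nonneg _)
  have n2 : ∀ u : Sph d → ℝ, 0 ≤ ∫ x, (1 - height e x ^ 2) * u x ^ 2 ∂(normSurface d) := fun u =>
    integral_nonneg fun x => mul_nonneg (hq x) (sq_nonneg _)
  have hmain := add_sq_le_of_sq_le (n1 _) (n2 _) (n1 _) (n2 _)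
    (integral_height_mul_sq_le hd e hf.1.re hg.re (hs.re hf.1 hg))
    (integral_height_mul_sq_le hd e hf.1.im hg.im (hs.im hf.1 hg))
  rw [← mul_add, ← mul_add, ← integral_mul_norm_sq ct hf.1, ← integral_mul_norm_sq cq hf.1,
    ← integral_norm_sq hg, ← gradNorm_sq, hτ, mul_pow] at hmain
  exact hmain.trans (mul_le_mul_of_nonneg_left hW (by positivity))

lemma sub_one_le_gradNorm_sq (hd : 2 ≤ d) {f : Sph d → 𝕜} (hf : MemSobolev f)
    (hmean : ∫ x, f x ∂(normSurface d) = 0) (h : l2Norm f = 1) :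
    (d : ℝ) - 1 ≤ gradNorm f ^ 2 := by
  obtain ⟨B⟩ := nonempty_harmonicBasis hd
  obtain ⟨hg, hs⟩ := hf.sqrtNegLaplacian_spec
  have h1 := B.poincare hd hf.1.re hg.re (hs.re hf.1 hg) (integral_re_eq_zero hf.1 hmean)
  have h2 := B.poincare hd hf.1.im hg.im (hs.im hf.1 hg) (integral_im_eq_zero hf.1 hmean)
  have h3 := add_le_add h1 h2
  rw [← mul_add, ← integral_norm_sq hf.1, ← integral_norm_sq hg, ← gradNorm_sq,
    integral_norm_sq_eq_one h, mul_one] at h3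
  exact h3

/-- Two lower bounds for `(1 - τ) N` are available: `(1 - τ) (D - 1)`, decreasing in `τ`, and `(D -
1)² τ² / (4 (1 + τ))`, increasing in `τ`. They agree when `τ² (D + 3) = 4`, that is at `r = 2 / √(D
+ 3)`. -/
lemma uncertainty_arith {D τ N : ℝ} (hD : 3 ≤ D) (h0 : 0 ≤ τ) (hN : D - 1 ≤ N)
    (h : (D - 1) ^ 2 * τ ^ 2 ≤ 4 * N * (1 - τ ^ 2)) :
    (D - 1) * (1 - 2 / Real.sqrt (D + 3)) ≤ (1 - τ) * N := by
  have hs : 0 < Real.sqrt (D + 3) := Real.sqrt_pos.2 (by linarith)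
  have hs2 : Real.sqrt (D + 3) ^ 2 = D + 3 := Real.sq_sqrt (by linarith)
  set s := Real.sqrt (D + 3)
  have hs1 : 2 < s := by nlinarith
  set r := 2 / s with hr
  have hr0 : 0 < r := by positivity
  have hr1 : r < 1 := by rw [hr, div_lt_one hs]; exact hs1
  have hrD : r ^ 2 * (D + 3) = 4 := by
    rw [hr, ← hs2]
    field_simp
    norm_num
  rcases le_or_gt τ r with hτ | hτ
  · calc (D - 1) * (1 - r) ≤ N * (1 - r) := mul_le_mul_of_nonneg_right hN (by linarith)
      _ ≤ N * (1 - τ) := mul_le_mul_of_nonneg_left (by linarith) (by linarith)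
      _ = _ := mul_comm _ _
  -- Monotonicity of `x² / (1 + x)` between `r` and `τ`, with denominators cleared.
  · have k1 : r ^ 2 * (1 + τ) ≤ (1 + r) * τ ^ 2 := by
      nlinarith [mul_nonneg (mul_nonneg hr0.le h0) (sub_nonneg.2 hτ.le)]
    have k2 : 4 * (1 - r) * (1 + τ) ≤ (D - 1) * τ ^ 2 := by
      have k3 : r ^ 2 * (4 * (1 - r) * (1 + τ)) ≤ r ^ 2 * ((D - 1) * τ ^ 2) := by
        have k4 : r ^ 2 * (D - 1) = 4 * (1 - r) * (1 + r) := by linear_combination hrD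
        calc r ^ 2 * (4 * (1 - r) * (1 + τ)) = 4 * (1 - r) * (r ^ 2 * (1 + τ)) := by ring
          _ ≤ 4 * (1 - r) * ((1 + r) * τ ^ 2) := mul_le_mul_of_nonneg_left k1 (by linarith)
          _ = r ^ 2 * ((D - 1) * τ ^ 2) := by linear_combination (-τ ^ 2) * k4
      exact le_of_mul_le_mul_left k3 (by positivity)
    have k5 : (4 * (1 + τ)) * ((D - 1) * (1 - r)) ≤ (4 * (1 + τ)) * ((1 - τ) * N) := by
      calc _ = (D - 1) * (4 * (1 - r) * (1 + τ)) := by ring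
        _ ≤ (D - 1) * ((D - 1) * τ ^ 2) := mul_le_mul_of_nonneg_left k2 (by linarith)
        _ = (D - 1) ^ 2 * τ ^ 2 := by ring
        _ ≤ _ := h
        _ = _ := by ring
    exact le_of_mul_le_mul_left k5 (by linarith)

/-- A Hardy-Rellich constant gives an uncertainty principle. -/
lemma inv_le_of_isHardyRellichConst (hd : 2 ≤ d) {f : Sph d → 𝕜} (hf : MemSobolev f)
    (hmean : ∫ x, f x ∂(normSurface d) = 0) (hnorm : l2Norm f = 1) {C : ℝ} (hC : 0 < C)
    (h : IsHardyRellichConst 𝕜 d C) : C⁻¹ ≤ (1 - ‖tau f‖) * gradNorm f ^ 2 := by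
  obtain ⟨B⟩ := nonempty_harmonicBasis hd
  obtain ⟨hh, hs⟩ := hf.sqrtNegLaplacian_spec
  obtain ⟨g, hg, hg0, hgs⟩ := exists_isSqrtNegLaplacian hd hf.1 hmean
  have hgS : MemSobolev g := ⟨hg, f, hf.1, hgs⟩
  obtain ⟨hk, hks⟩ := hgS.sqrtNegLaplacian_spec
  -- The Hardy-Rellich inequality is applied to `g = (-Δ₀)^(-1/2) f`, and this turns its right-hand
  -- side into an integral of `|f|²`.
  have hae := ae_eq_of_isSqrtNegLaplacian hd hg hk hf.1 hks hgs
  obtain ⟨e, he⟩ := exists_inner_tau_eq_norm hd f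
  have h1 : ∫ x, ‖g x‖ ^ 2 ∂(normSurface d) ≤ C * (1 - ‖tau f‖) := by
    have h2 := h g hgS hg0 e
    have h3 : ∫ x : Sph d, (1 - inner ℝ (x : EuclideanSpace ℝ (Fin d))
        (e : EuclideanSpace ℝ (Fin d))) * ‖sqrtNegLaplacian g x‖ ^ 2 ∂(normSurface d) =
        ∫ x, (1 - height e x) * ‖f x‖ ^ 2 ∂(normSurface d) := by
      refine integral_congr_ae ?_
      filter_upwards [hae] with x hx
      rw [hx, height]
    rwa [h3, integral_one_sub_height_mul hf.1 hnorm, he] at h2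
  have n0 : ∀ u : Sph d → ℝ, 0 ≤ ∫ x, u x ^ 2 ∂(normSurface d) := fun u =>
    integral_nonneg fun x => sq_nonneg _
  -- After the rewriting below this reads `1 ≤ ‖∇₀ f‖² ‖g‖²`.
  have h4 := add_sq_le_of_sq_le (n0 _) (n0 _) (n0 _) (n0 _)
    (integral_mul_sq_le hh.re hg.re) (integral_mul_sq_le hh.im hg.im)
  rw [← integral_norm_sq hg, ← integral_norm_sq hh, ← gradNorm_sq,
    ← B.integral_sq_eq_integral_mul hf.1.re hg.re hh.re (hs.re hf.1 hh) (hgs.re hg hf.1),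
    ← B.integral_sq_eq_integral_mul hf.1.im hg.im hh.im (hs.im hf.1 hh) (hgs.im hg hf.1),
    ← integral_norm_sq hf.1, integral_norm_sq_eq_one hnorm, one_pow] at h4
  rw [inv_le_iff_one_le_mul₀' hC]
  calc (1 : ℝ) ≤ gradNorm f ^ 2 * ∫ x, ‖g x‖ ^ 2 ∂(normSurface d) := h4
    _ ≤ gradNorm f ^ 2 * (C * (1 - ‖tau f‖)) := mul_le_mul_of_nonneg_left h1 (sq_nonneg _)
    _ = _ := by ring

end Uncertainty

end SphereUncertainty

end

theorem mainTheorem7 {𝕜 : Type*} [RCLike 𝕜] (d : ℕ) (hd : 2 ≤ d)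
    (f : SphereUncertainty.Sph d → 𝕜) (hf : SphereUncertainty.MemSobolev f)
    (hmean : ∫ x, f x ∂(SphereUncertainty.normSurface d) = 0)
    (hnorm : SphereUncertainty.l2Norm f = 1) :
    -- `‖∇₀ f‖₂` is the `L²` norm of the tangential gradient when that exists classically
    (SphereUncertainty.IsC1 f →
      SphereUncertainty.gradNorm f ^ 2 =
        ∫ x, SphereUncertainty.tangentGradSq f x ∂(SphereUncertainty.normSurface d)) ∧
    -- `1 - ‖τ(f)‖` is the minimum over `e` of the mean of `(1 - ⟨x, e⟩) |f|²`
    IsLeast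
      (Set.range fun e : SphereUncertainty.Sph d =>
        ∫ x : SphereUncertainty.Sph d,
          (1 - inner ℝ (x : EuclideanSpace ℝ (Fin d)) (e : EuclideanSpace ℝ (Fin d))) *
            ‖f x‖ ^ 2 ∂(SphereUncertainty.normSurface d))
      (1 - ‖SphereUncertainty.tau f‖) ∧
    -- the explicit constant for `d ≥ 3`
    (3 ≤ d →
      (1 - ‖SphereUncertainty.tau f‖) * SphereUncertainty.gradNorm f ^ 2 ≥
        ((d : ℝ) - 1) * (1 - 2 / Real.sqrt ((d : ℝ) + 3))) ∧
    -- for `d ≠ 3`, the constant `C⁻¹`, where `C` is any constant in the Hardy-Rellich inequality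
    (d ≠ 3 →
      (∃ C : ℝ, 0 < C ∧ SphereUncertainty.IsHardyRellichConst 𝕜 d C) ∧
      ∀ C : ℝ, 0 < C → SphereUncertainty.IsHardyRellichConst 𝕜 d C →
        (1 - ‖SphereUncertainty.tau f‖) * SphereUncertainty.gradNorm f ^ 2 ≥ C⁻¹) ∧
    -- the explicit constant for `d = 2`
    (d = 2 →
      (1 - ‖SphereUncertainty.tau f‖) * SphereUncertainty.gradNorm f ^ 2 ≥ 1 / 8) := by
  open SphereUncertainty in
  refine ⟨gradNorm_sq_eq_integral_tangentGradSq hd hf, isLeast_one_sub_norm_tau hd hf.1 hnorm,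
    fun hd3 => ?_, fun hd3 => ⟨?_, fun C hC h => inv_le_of_isHardyRellichConst hd hf hmean hnorm hC h⟩,
    fun hd2 => ?_⟩
  · exact uncertainty_arith (by exact_mod_cast hd3) (norm_nonneg _) (sub_one_le_gradNorm_sq hd hf hmean hnorm)
      (sub_one_sq_mul_norm_tau_sq_le hd hf hnorm)
  · rcases Nat.lt_or_ge d 4 with h | h
    · exact ⟨8, by norm_num, isHardyRellichConst_eight (by omega)⟩
    · exact ⟨10, by norm_num, isHardyRellichConst_ten h⟩
  · have h := inv_le_of_isHardyRellichConst hd hf hmean hnorm (C := 8) (by norm_num)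
      (isHardyRellichConst_eight hd2)
    rw [ge_iff_le, one_div]
    exact h
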